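/- **Conventions.** Let $\mathcal C$ be a small category equipped with an ordinal-valued degree function $\deg$ on its objects. For an ordinal $\delta$, let $\mathcal C_\delta\subseteq\mathcal C$ be the full subcategory of objects of degree $<\delta$, with inclusion $\iota_\delta$. For weights $W:\mathcal D\to\mathrm{Set}$, $U:\mathcal D^{\mathrm{op}}\to\mathrm{Set}$ and a diagram $X:\mathcal D\to\mathcal M$, write $\{W,X\}^{\mathcal D}$ for the $W$-weighted limit and $U\otimes_{\mathcal D}X$ for the $U$-weighted colimit. For $A\in\mathcal M^{\mathcal C}$ and $x\in\mathcal C$ of degree $\delta$, the matching and latching objects are $$M_xA=\{\mathcal C(x,-),\iota_\delta^*A\}^{\mathcal C_\delta},\qquad L_xA=\mathcal C(-,x)\otimes_{\mathcal C_\delta}\iota_\delta^*A ,$$ with canonical maps $L_xA\to A_x\to M_xA$. *Abstract bigluing data* from a category $\mathcal B$ to a category $\mathcal D$ consist of functors $U:\mathcal B^{\mathrm{op}}\times\mathcal D\to\mathrm{Set}$ and $W:\mathcal D^{\mathrm{op}}\times\mathcal B\to\mathrm{Set}$ and maps $\alpha:W(d,b')\times U(b,d)\to\mathcal B(b,b')$,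 natural in $b,b'$ and dinatural in $d$. Their *collage* is the category whose objects are those of $\mathcal B$ and of $\mathcal D$ (disjoint union), with hom-sets $\mathcal B(b,b')$ from $b$ to $b'$, $U(b,d)$ from $b$ to $d$, $W(d,b)$ from $d$ to $b$, and $\mathcal D(d,d')\sqcup(U\otimes_{\mathcal B}W)(d,d')$ from $d$ to $d'$, with composition induced by the given structure. $\mathcal C$ is *bistratified with discrete strata* (with respect to $\deg$) if for every ordinal $\delta$ the inclusion $\mathcal C_\delta\to\mathcal C_{\delta+1}$ is isomorphic, under $\mathcal C_\delta$, to the inclusion of $\mathcal C_\delta$ in the collage of some abstract bigluing data from $\mathcal C_\delta$ to a discrete category. For a category $\mathcal D$ with degree function, $X\in\mathrm{Set}^{\mathcal D}$ is an *$\mathcal L$-object* if the map $A=\emptyset\to X$ is such that $L_yX\sqcup_{L_yA}A_y\to X_y$ is injective for all $y\in\mathcal D$. $\mathcal C$ is *almost-Reedy* if it is bistratified with discrete strata and, for every object $x$ of degree $\beta$, the functors $\mathcal C(x,-)\in\mathrm{Set}^{\mathcal C_\beta}$ and $\mathcal C(-,x)\in\mathrm{Set}^{\mathcal C_\beta^{\mathrm{op}}}$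 are $\mathcal L$-objects ($\mathcal C_\beta$ and $\mathcal C_\beta^{\mathrm{op}}$ carrying the degrees of $\mathcal C$). **Theorem.** Let $\mathcal C$ be almost-Reedy. Then for any model category $\mathcal M$ (complete and cocomplete), the functor category $\mathcal M^{\mathcal C}$ has a model structure such that * $A\to B$ is a weak equivalence iff $A_x\to B_x$ is a weak equivalence in $\mathcal M$ for all $x\in\mathcal C$; * $A\to B$ is a fibration (resp. acyclic fibration) iff for all $x\in\mathcal C$ the induced map $A_x\to M_xA\times_{M_xB}B_x$ is a fibration (resp. acyclic fibration) in $\mathcal M$; * $A\to B$ is a cofibration (resp. acyclic cofibration) iff for all $x\in\mathcal C$ the induced map $L_xB\sqcup_{L_xA}A_x\to B_x$ is a cofibration (resp. acyclic cofibration) in $\mathcal M$. -/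

import Mathlib

open CategoryTheory CategoryTheory.Limits Opposite HomotopicalAlgebra

universe t v w u

/-- Abstract bigluing data from `C` to `D`: profunctors `U : D ⇸ C` and `W : C ⇸ D` and a map of
profunctors `α : W ⊗_D U ⟶ C(-, -)`. A profunctor `C ⇸ D` is a functor `Dᵒᵖ × C ⥤ Type`, and the
elements of `U(c, d)`, resp. `W(d, c)`, play the role of arrows `c ⟶ d`, resp. `d ⟶ c`.
The map out of the coend `W ⊗_D U` is given by its components `W(d, c') × U(c, d) → C(c, c')`,
natural in `c` and `c'` and balanced in `d`. -/
structure BigluingData (C D : Type u) [Category.{u} C] [Category.{u} D] where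
  U : Profunctor.{u} D C
  W : Profunctor.{u} C D
  α {c c' : C} {d : D} (p : (U.obj d).obj (op c)) (q : (W.obj c').obj (op d)) : c ⟶ c'
  α_precomp {c₀ c c' : C} {d : D} (f : c₀ ⟶ c) (p : (U.obj d).obj (op c))
    (q : (W.obj c').obj (op d)) : α ((U.obj d).map f.op p) q = f ≫ α p q
  α_postcomp {c c' c₁ : C} {d : D} (p : (U.obj d).obj (op c)) (q : (W.obj c').obj (op d))
    (g : c' ⟶ c₁) : α p ((W.map g).app (op d) q) = α p q ≫ g
  α_balanced {c c' : C} {d d' : D} (p : (U.obj d).obj (op c)) (k : d ⟶ d')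
    (q : (W.obj c').obj (op d')) : α ((U.map k).app (op c) p) q = α p ((W.obj c').map k.op q)

namespace BigluingData

variable {C D : Type u} [Category.{u} C] [Category.{u} D] (B : BigluingData C D)

/-- The set `U(c, d)`. -/
abbrev HomU (c : C) (d : D) : Type u := (B.U.obj d).obj (op c)
/-- The set `W(d, c)`. -/
abbrev HomW (d : D) (c : C) : Type u := (B.W.obj c).obj (op d)

section

variable {B}

/-- Action of an arrow of `C` on `U`. -/
def preU {c c' : C} {d : D} (f : c ⟶ c') (p : B.HomU c' d) : B.HomU c d := (B.U.obj d).map f.op p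
/-- Action of an arrow of `D` on `U`. -/
def postU {c : C} {d d' : D} (p : B.HomU c d) (k : d ⟶ d') : B.HomU c d' := (B.U.map k).app (op c) p
/-- Action of an arrow of `D` on `W`. -/
def preW {d d' : D} {c : C} (k : d ⟶ d') (q : B.HomW d' c) : B.HomW d c := (B.W.obj c).map k.op q
/-- Action of an arrow of `C` on `W`. -/
def postW {d : D} {c c' : C} (q : B.HomW d c) (f : c ⟶ c') : B.HomW d c' := (B.W.map f).app (op d) q

@[simp] lemma preU_id {c : C} {d : D} (p : B.HomU c d) : preU (𝟙 c) p = p := by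
  simp [preU]
@[simp] lemma postU_id {c : C} {d : D} (p : B.HomU c d) : postU p (𝟙 d) = p := by
  simp [postU]
@[simp] lemma preW_id {d : D} {c : C} (q : B.HomW d c) : preW (𝟙 d) q = q := by
  simp [preW]
@[simp] lemma postW_id {d : D} {c : C} (q : B.HomW d c) : postW q (𝟙 c) = q := by
  simp [postW]
@[simp] lemma preU_comp {c c' c'' : C} {d : D} (f : c ⟶ c') (g : c' ⟶ c'') (p : B.HomU c'' d) :
    preU (f ≫ g) p = preU f (preU g p) := by
  simp [preU]
@[simp] lemma postU_comp {c : C} {d d' d'' : D} (p : B.HomU c d) (k : d ⟶ d') (l : d' ⟶ d'') :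
    postU p (k ≫ l) = postU (postU p k) l := by
  simp [postU]
@[simp] lemma preW_comp {d d' d'' : D} {c : C} (k : d ⟶ d') (l : d' ⟶ d'') (q : B.HomW d'' c) :
    preW (k ≫ l) q = preW k (preW l q) := by
  simp [preW]
@[simp] lemma postW_comp {d : D} {c c' c'' : C} (q : B.HomW d c) (f : c ⟶ c') (g : c' ⟶ c'') :
    postW q (f ≫ g) = postW (postW q f) g := by
  simp [postW]
@[simp] lemma preU_postU {c c' : C} {d d' : D} (f : c ⟶ c') (p : B.HomU c' d) (k : d ⟶ d') :
    postU (preU f p) k = preU f (postU p k) := by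
  exact (B.U.map k).naturality_apply f.op p
@[simp] lemma preW_postW {c c' : C} {d d' : D} (k : d ⟶ d') (q : B.HomW d' c) (f : c ⟶ c') :
    postW (preW k q) f = preW k (postW q f) := by
  exact (B.W.map f).naturality_apply k.op q
@[simp] lemma α_preU {c₀ c c' : C} {d : D} (f : c₀ ⟶ c) (p : B.HomU c d) (q : B.HomW d c') :
    B.α (preU f p) q = f ≫ B.α p q := B.α_precomp f p q
@[simp] lemma α_postW {c c' c₁ : C} {d : D} (p : B.HomU c d) (q : B.HomW d c') (g : c' ⟶ c₁) :
    B.α p (postW q g) = B.α p q ≫ g := B.α_postcomp p q g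
@[simp] lemma α_postU {c c' : C} {d d' : D} (p : B.HomU c d) (k : d ⟶ d') (q : B.HomW d' c') :
    B.α (postU p k) q = B.α p (preW k q) := B.α_balanced p k q

end

/-- The relation `(q, p ∘ k) ∼ (k ∘ q, p)` whose quotient is the tensor product. -/
inductive TensorRel (d d' : D) :
    (Σ c : C, B.HomW d c × B.HomU c d') → (Σ c : C, B.HomW d c × B.HomU c d') → Prop
  | slide {c c' : C} (q : B.HomW d c) (k : c ⟶ c') (p : B.HomU c' d') :
      TensorRel d d' ⟨c, q, preU k p⟩ ⟨c', postW q k, p⟩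

/-- The tensor product `(U ⊗_C W)(d, d')`: formal composites `d ⟶ c ⟶ d'` with `c` in `C`,
modulo the equivalence relation generated by `TensorRel`. -/
def Tensor (d d' : D) : Type u := Quot (B.TensorRel d d')

namespace Tensor
variable {B}

/-- The class of a formal composite. -/
def mk {d d' : D} {c : C} (q : B.HomW d c) (p : B.HomU c d') : B.Tensor d d' :=
  Quot.mk _ ⟨c, q, p⟩

@[simp] lemma mk_preU {d d' : D} {c c' : C} (q : B.HomW d c) (k : c ⟶ c') (p : B.HomU c' d') :
    mk q (preU k p) = mk (postW q k) p :=
  Quot.sound (.slide q k p)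

/-- Maps out of the tensor product. -/
def lift {d d' : D} {T : Type u} (φ : ∀ c : C, B.HomW d c → B.HomU c d' → T)
    (hφ : ∀ (c c' : C) (q : B.HomW d c) (k : c ⟶ c') (p : B.HomU c' d'),
      φ c q (preU k p) = φ c' (postW q k) p) : B.Tensor d d' → T :=
  Quot.lift (fun t ↦ φ t.1 t.2.1 t.2.2) (by rintro _ _ ⟨q, k, p⟩; exact hφ _ _ q k p)

@[simp] lemma lift_mk {d d' : D} {T : Type u} (φ : ∀ c : C, B.HomW d c → B.HomU c d' → T)
    (hφ) {c : C} (q : B.HomW d c) (p : B.HomU c d') : lift φ hφ (mk q p) = φ c q p := rfl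

lemma exists_rep {d d' : D} (t : B.Tensor d d') :
    ∃ (c : C) (q : B.HomW d c) (p : B.HomU c d'), t = mk q p := by
  obtain ⟨⟨c, q, p⟩⟩ := t
  exact ⟨c, q, p, rfl⟩

end Tensor

/-- Objects of the collage: the disjoint union of the objects of `C` and of `D`. -/
inductive Collage (B : BigluingData C D) : Type u
  | left (c : C)
  | right (d : D)

namespace Collage

/-- Arrows of the collage: `C(c, c')`, `U(c, d)`, `W(d, c)`, and the disjoint union
of `D(d, d')` and `(U ⊗_C W)(d, d')`. -/
inductive Hom : B.Collage → B.Collage → Type u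
  | ll {c c' : C} (f : c ⟶ c') : Hom (.left c) (.left c')
  | lr {c : C} {d : D} (p : B.HomU c d) : Hom (.left c) (.right d)
  | rl {d : D} {c : C} (q : B.HomW d c) : Hom (.right d) (.left c)
  | rr {d d' : D} (k : d ⟶ d') : Hom (.right d) (.right d')
  | tensor {d d' : D} (t : B.Tensor d d') : Hom (.right d) (.right d')

/-- Identities of the collage. -/
def id : ∀ X : B.Collage, Hom B X X
  | .left c => .ll (𝟙 c)
  | .right d => .rr (𝟙 d)

variable {B} in
/-- Composition in the collage; composites `c ⟶ d ⟶ c'` are evaluated by `α`. -/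
def comp : ∀ {X Y Z : B.Collage}, Hom B X Y → Hom B Y Z → Hom B X Z
  | _, _, _, .ll f, .ll g => .ll (f ≫ g)
  | _, _, _, .ll f, .lr p => .lr (preU f p)
  | _, _, _, .lr p, .rl q => .ll (B.α p q)
  | _, _, _, .lr p, .rr k => .lr (postU p k)
  | _, _, _, .lr p, .tensor t =>
      .lr (t.lift (fun _ q p' ↦ preU (B.α p q) p') (by simp))
  | _, _, _, .rl q, .ll f => .rl (postW q f)
  | _, _, _, .rl q, .lr p => .tensor (.mk q p)
  | _, _, _, .rr k, .rl q => .rl (preW k q)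
  | _, _, _, .rr k, .rr l => .rr (k ≫ l)
  | _, _, _, .rr k, .tensor t =>
      .tensor (t.lift (fun _ q p ↦ .mk (preW k q) p) (by simp))
  | _, _, _, .tensor t, .rl q =>
      .rl (t.lift (fun _ q' p ↦ postW q' (B.α p q)) (by simp))
  | _, _, _, .tensor t, .rr k =>
      .tensor (t.lift (fun _ q p ↦ .mk q (postU p k)) (by simp))
  | _, _, _, .tensor t, .tensor s =>
      .tensor (t.lift (fun _ q p ↦ s.lift (fun _ q' p' ↦ .mk (postW q (B.α p q')) p')
        (by simp)) (by simp))

instance : Category.{u} B.Collage where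
  Hom := Hom B
  id := id B
  comp := comp
  id_comp f := by
    rcases f with f | p | q | k | t
    all_goals try obtain ⟨c, q, p, rfl⟩ := t.exists_rep
    all_goals simp [id, comp]
  comp_id f := by
    rcases f with f | p | q | k | t
    all_goals try obtain ⟨c, q, p, rfl⟩ := t.exists_rep
    all_goals simp [id, comp]
  assoc f g h := by
    rcases f with f | p | q | k | t <;> rcases g with f' | p' | q' | k' | t' <;>
      rcases h with f'' | p'' | q'' | k'' | t''
    all_goals try obtain ⟨c, q, p, rfl⟩ := t.exists_rep
    all_goals try obtain ⟨c', q', p', rfl⟩ := t'.exists_rep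
    all_goals try obtain ⟨c'', q'', p'', rfl⟩ := t''.exists_rep
    all_goals simp [comp]

/-- The inclusion of `C` in the collage. -/
def inclusion : C ⥤ B.Collage where
  obj := .left
  map f := Hom.ll f

end Collage
end BigluingData

section Degree

variable {C : Type u} [Category.{u} C] (deg : C → Ordinal.{t})

/-- The objects of degree `< δ`. -/
abbrev degreeLT (δ : Ordinal.{t}) : ObjectProperty C := fun x ↦ deg x < δ

/-- The full subcategory `C_δ` of the objects of degree `< δ`. -/
abbrev Below (δ : Ordinal.{t}) : Type u := (degreeLT deg δ).FullSubcategory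

/-- The inclusion `ι_δ : C_δ ⥤ C`. -/
abbrev Below.ι (δ : Ordinal.{t}) : Below deg δ ⥤ C := (degreeLT deg δ).ι

/-- `C`, with the degree function `deg`, is bistratified with discrete strata: for every ordinal
`δ`, the category `C_{δ+1}` is isomorphic, under `C_δ`, to the collage of some abstract bigluing
data from `C_δ` to a discrete category. The objects added at this step are then exactly those of
degree `δ`. At the bottom `C_0` is empty, and at limit ordinals `δ` the category `C_δ` is the union
(colimit) of the `C_γ` for `γ < δ`, since all of them are full subcategories of `C`; similarly
`C` itself is `C_β` for any `β` larger than all the degrees (the height). -/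
def IsBistratifiedDiscrete : Prop :=
  ∀ δ : Ordinal.{t}, ∃ (I : Type u) (B : BigluingData (Below deg δ) (Discrete I))
    (Φ : B.Collage ⥤ Below deg (δ + 1)),
    Φ.Full ∧ Φ.Faithful ∧ Function.Bijective Φ.obj ∧
      BigluingData.Collage.inclusion B ⋙ Φ ⋙ Below.ι deg (δ + 1) = Below.ι deg δ

end Degree

section WeightedColimit

variable {C : Type u} [Category.{u} C] {M : Type w} [Category.{v} M] [HasColimitsOfSize.{u, u} M]

/-- The weighted colimit `U ⊗_C X` for a weight `U : Cᵒᵖ ⥤ Type u`, as the colimit of `X` over the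
category of elements of `U`; this is dual to Mathlib's `Functor.weightedLimObjObj`. -/
noncomputable def weightedColim (U : Cᵒᵖ ⥤ Type u) (X : C ⥤ M) : M :=
  colimit ((CategoryOfElements.π U).leftOp ⋙ X)

/-- The coprojections `X c ⟶ U ⊗_C X` for `p : U c`. -/
noncomputable def weightedColim.ι (U : Cᵒᵖ ⥤ Type u) (X : C ⥤ M) {c : C} (p : U.obj (op c)) :
    X.obj c ⟶ weightedColim U X :=
  colimit.ι ((CategoryOfElements.π U).leftOp ⋙ X) (op (U.elementsMk (op c) p))

/-- Functoriality of the weighted colimit in the diagram. -/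
noncomputable def weightedColim.map (U : Cᵒᵖ ⥤ Type u) {X Y : C ⥤ M} (f : X ⟶ Y) :
    weightedColim U X ⟶ weightedColim U Y :=
  colimMap (Functor.whiskerLeft _ f)

lemma weightedColim.ι_map (U : Cᵒᵖ ⥤ Type u) {X Y : C ⥤ M} (f : X ⟶ Y) {c : C}
    (p : U.obj (op c)) :
    weightedColim.ι U X p ≫ weightedColim.map U f = f.app c ≫ weightedColim.ι U Y p := by
  exact ι_colimMap _ _

/-- Maps out of the weighted colimit. -/
noncomputable def weightedColim.desc (U : Cᵒᵖ ⥤ Type u) (X : C ⥤ M) {Z : M}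
    (φ : ∀ ⦃c : C⦄, U.obj (op c) → (X.obj c ⟶ Z))
    (hφ : ∀ ⦃c c' : C⦄ (k : c ⟶ c') (p : U.obj (op c')), φ (U.map k.op p) = X.map k ≫ φ p) :
    weightedColim U X ⟶ Z :=
  colimit.desc ((CategoryOfElements.π U).leftOp ⋙ X)
    { pt := Z
      ι :=
        { app := fun e ↦ φ e.unop.2
          naturality := fun e e' k ↦ by
            have h := hφ k.unop.val.unop e'.unop.2
            rw [Quiver.Hom.op_unop, k.unop.property] at h
            exact h.symm.trans (Category.comp_id _).symm } }

lemma weightedColim.ι_desc (U : Cᵒᵖ ⥤ Type u) (X : C ⥤ M) {Z : M}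
    (φ : ∀ ⦃c : C⦄, U.obj (op c) → (X.obj c ⟶ Z)) (hφ) {c : C} (p : U.obj (op c)) :
    weightedColim.ι U X p ≫ weightedColim.desc U X φ hφ = φ p := by
  exact colimit.ι_desc _ _

lemma weightedColim.hom_ext {U : Cᵒᵖ ⥤ Type u} {X : C ⥤ M} {Z : M}
    {f g : weightedColim U X ⟶ Z}
    (h : ∀ (c : C) (p : U.obj (op c)), weightedColim.ι U X p ≫ f = weightedColim.ι U X p ≫ g) :
    f = g :=
  colimit.hom_ext fun e ↦ h e.unop.1.unop e.unop.2

end WeightedColimit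

section Reedy

variable {C : Type u} [Category.{u} C] (deg : C → Ordinal.{t}) {M : Type w} [Category.{v} M]

section Matching

variable [HasLimitsOfSize.{u, u} M] (x : C)

/-- The weight `C(x, -)` on `C_δ`. -/
abbrev homFrom (δ : Ordinal.{t}) : Below deg δ ⥤ Type u := Below.ι deg δ ⋙ coyoneda.obj (op x)

/-- The matching object `M_x A`: the limit of the restriction of `A` to `C_δ`, `δ = deg x`,
weighted by `C(x, -)`. -/
noncomputable abbrev matchingObj (A : C ⥤ M) : M :=
  (homFrom deg x (deg x)).weightedLimObjObj (Below.ι deg (deg x) ⋙ A)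

/-- The map `M_x A ⟶ M_x B` induced by `A ⟶ B`. -/
noncomputable def matchingMap {A B : C ⥤ M} (f : A ⟶ B) :
    matchingObj deg x A ⟶ matchingObj deg x B :=
  (homFrom deg x (deg x)).weightedLimObjMap (Functor.whiskerLeft (Below.ι deg (deg x)) f)

/-- The canonical map `A_x ⟶ M_x A`, whose component at `g : x ⟶ y` is `A g`. -/
noncomputable def toMatching (A : C ⥤ M) : A.obj x ⟶ matchingObj deg x A :=
  ((homFrom deg x (deg x)).isLimitWeightedLimCone (Below.ι deg (deg x) ⋙ A)).lift
    (fun _ g ↦ A.map g) (fun _ _ g k ↦ by simp)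

lemma toMatching_π (A : C ⥤ M) {y : Below deg (deg x)} (g : x ⟶ y.obj) :
    toMatching deg x A ≫
      (homFrom deg x (deg x)).weightedLimObjObjπ (Below.ι deg (deg x) ⋙ A) (j := y) g =
    A.map g := by
  unfold toMatching
  exact Functor.isLimitWeightedLimCone_fac (homFrom deg x (deg x)) (Below.ι deg (deg x) ⋙ A) _ _
    (j := y) g

lemma toMatching_naturality {A B : C ⥤ M} (f : A ⟶ B) :
    toMatching deg x A ≫ matchingMap deg x f = f.app x ≫ toMatching deg x B := by
  apply Functor.weightedLimObjObj.hom_ext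
  intro y g
  rw [matchingMap, Category.assoc, Category.assoc, Functor.weightedLimObjMap_π, toMatching_π,
    ← Category.assoc, toMatching_π]
  exact f.naturality g

/-- The relative matching map `A_x ⟶ M_x A ×_{M_x B} B_x`. -/
noncomputable def relMatching [HasPullbacks M] {A B : C ⥤ M} (f : A ⟶ B) :
    A.obj x ⟶ pullback (matchingMap deg x f) (toMatching deg x B) :=
  pullback.lift (toMatching deg x A) (f.app x) (toMatching_naturality deg x f)

end Matching

section Latching

variable [HasColimitsOfSize.{u, u} M] (x : C)

/-- The weight `C(-, x)` on `C_δ`. -/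
abbrev homTo (δ : Ordinal.{t}) : (Below deg δ)ᵒᵖ ⥤ Type u := (Below.ι deg δ).op ⋙ yoneda.obj x

/-- The latching object `L_x A`: the colimit of the restriction of `A` to `C_δ`, `δ = deg x`,
weighted by `C(-, x)`. -/
noncomputable abbrev latchingObj (A : C ⥤ M) : M :=
  weightedColim (homTo deg x (deg x)) (Below.ι deg (deg x) ⋙ A)

/-- The map `L_x A ⟶ L_x B` induced by `A ⟶ B`. -/
noncomputable def latchingMap {A B : C ⥤ M} (f : A ⟶ B) :
    latchingObj deg x A ⟶ latchingObj deg x B :=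
  weightedColim.map (homTo deg x (deg x)) (Functor.whiskerLeft (Below.ι deg (deg x)) f)

/-- The canonical map `L_x A ⟶ A_x`, whose component at `g : y ⟶ x` is `A g`. -/
noncomputable def fromLatching (A : C ⥤ M) : latchingObj deg x A ⟶ A.obj x :=
  weightedColim.desc (homTo deg x (deg x)) (Below.ι deg (deg x) ⋙ A)
    (fun _ g ↦ A.map g) (fun _ _ k g ↦ by simp)

lemma ι_fromLatching (A : C ⥤ M) {y : Below deg (deg x)} (g : y.obj ⟶ x) :
    weightedColim.ι (homTo deg x (deg x)) (Below.ι deg (deg x) ⋙ A) (c := y) g ≫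
      fromLatching deg x A = A.map g := by
  unfold fromLatching
  exact weightedColim.ι_desc (homTo deg x (deg x)) (Below.ι deg (deg x) ⋙ A) _ _ (c := y) g

lemma fromLatching_naturality {A B : C ⥤ M} (f : A ⟶ B) :
    latchingMap deg x f ≫ fromLatching deg x B = fromLatching deg x A ≫ f.app x := by
  apply weightedColim.hom_ext
  intro y g
  rw [latchingMap, ← Category.assoc, ← Category.assoc, weightedColim.ι_map, ι_fromLatching,
    Category.assoc, ι_fromLatching]
  exact (f.naturality g).symm

/-- The relative latching map `L_x B ⊔_{L_x A} A_x ⟶ B_x`. -/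
noncomputable def relLatching [HasPushouts M] {A B : C ⥤ M} (f : A ⟶ B) :
    pushout (latchingMap deg x f) (fromLatching deg x A) ⟶ B.obj x :=
  pushout.desc (fromLatching deg x B) (f.app x) (fromLatching_naturality deg x f)

end Latching

/-- The left class of the Reedy weak factorization system on `Set^C` induced by
(injections, surjections): the maps whose relative latching maps are injective. -/
def reedyInjections : MorphismProperty (C ⥤ Type u) :=
  fun _ _ f ↦ ∀ x : C, Function.Injective (relLatching deg x f)

/-- `X` is an `L`-object of `Set^C` if `∅ ⟶ X` is in the left class of the Reedy weak factorization
system. -/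
def IsReedyLObject (X : C ⥤ Type u) : Prop :=
  reedyInjections deg (initial.to X)

/-- `C`, with the degree function `deg`, is almost-Reedy: it is bistratified with discrete strata,
and for every object `x` of degree `β` the functors `C(x, -)` on `C_β` and `C(-, x)` on `C_βᵒᵖ`
are `L`-objects (`C_β` and `C_βᵒᵖ` having the same degrees as `C`). -/
structure IsAlmostReedy : Prop where
  bistratified : IsBistratifiedDiscrete deg
  homFrom_isReedyLObject (x : C) :
    IsReedyLObject (fun y : Below deg (deg x) ↦ deg y.obj) (homFrom deg x (deg x))
  homTo_isReedyLObject (x : C) :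
    IsReedyLObject (fun y : (Below deg (deg x))ᵒᵖ ↦ deg y.unop.obj) (homTo deg x (deg x))

end Reedy

/-! ### Factorizations through objects of lower degree -/

section LowFactorization

variable {C : Type u} [Category.{v} C] (deg : C → Ordinal.{t})

/-! Bistratification with discrete strata is used only through three consequences. A map between
objects of equal degree is an identity or factors through lower degree (`EqOrFactors`). An identity
never so factors (`comp_ne_id`). Any two such factorizations of the same map are joined by a zigzag
(`connected`), because the tensor product `U ⊗ W` embeds in the hom-sets of the collage.

These give a Reedy weak factorization system on `C ⥤ M` for every weak factorization system `(L, R)`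
on `M`. Lifts are built by induction on the degree: the lifts at objects of degree `δ` are chosen
independently, each in a square between a relative latching map and a relative matching map, and
naturality within the stratum is automatic since nonidentity maps pass through lower degree
(`hasLiftingProperty_of_latchingLifts`). Factorizations are extended one stratum at a time by
factoring `L_x E ⊔_{L_x A} A_x ⟶ M_x E ×_{M_x B} B_x`. A nonidentity map of the stratum acts through
any of its lower factorizations, and the zigzags make this well defined
(`exists_reedy_factorization`).

The two systems obtained from `M` fit into one model structure once the Reedy maps for the acyclic
classes are identified with the Reedy (co)fibrations that are objectwise weak equivalences. For this
it suffices that `L_x A ⟶ L_x B` is an acyclic cofibration when the relative latching maps below `x`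
are, and dually (`latchingMap_mem`, `matchingMap_mem`). A lifting problem for `L_x A ⟶ L_x B`
against `p` transposes to one against the constant diagram at `p`, over the category of lower-degree
maps to `x`. There the matching object of a constant diagram at `g : y ⟶ x` is a power indexed by
the zigzag classes of factorizations of `g` through degree `< deg y`. The `L`-object condition on
`C(-, x)` says that there is at most one class, so the relative matching map is either `p` or an
isomorphism. The condition on `C(x, -)` serves the matching side in the same way. -/

/-- The factorizations `x ⟶ z ⟶ y` through an object `z` of degree `< δ`. -/
structure LowFactorization (δ : Ordinal.{t}) (x y : C) where
  mid : C
  lt : deg mid < δ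
  fst : x ⟶ mid
  snd : mid ⟶ y

namespace LowFactorization

variable {deg} {δ : Ordinal.{t}} {x y : C}

/-- The composite of a factorization. -/
def comp (s : LowFactorization deg δ x y) : x ⟶ y := s.fst ≫ s.snd

/-- A map of factorizations. -/
def Slide (s s' : LowFactorization deg δ x y) : Prop :=
  ∃ m : s.mid ⟶ s'.mid, s.fst ≫ m = s'.fst ∧ m ≫ s'.snd = s.snd

lemma eq_of_eqvGen {T : Type*} (φ : LowFactorization deg δ x y → T)
    (hφ : ∀ s s', Slide s s' → φ s = φ s') {s s' : LowFactorization deg δ x y}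
    (h : Relation.EqvGen Slide s s') : φ s = φ s' := by
  induction h with
  | rel _ _ h => exact hφ _ _ h
  | refl => rfl
  | symm _ _ _ ih => exact ih.symm
  | trans _ _ _ _ _ ih ih' => exact ih.trans ih'

lemma Slide.comp_eq {s s' : LowFactorization deg δ x y} (h : Slide s s') : s.comp = s'.comp := by
  obtain ⟨m, h₁, h₂⟩ := h
  simp [comp, ← h₁, ← h₂]

/-- Slides preserve the composite, so a zigzag whose ends compose to `k` consists of factorizations
of `k`. Hence `φ` need only be defined on those. -/
lemma eq_of_eqvGen_of_comp_eq {T : Type*} (k : x ⟶ y)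
    (φ : ∀ s : LowFactorization deg δ x y, s.comp = k → T)
    (hφ : ∀ s s' hs hs', Slide s s' → φ s hs = φ s' hs') {s s' : LowFactorization deg δ x y}
    (h : Relation.EqvGen Slide s s') (hs : s.comp = k) (hs' : s'.comp = k) :
    φ s hs = φ s' hs' := by
  induction h with
  | rel _ _ h => exact hφ _ _ _ _ h
  | refl => rfl
  | symm _ _ _ ih => exact (ih _ _).symm
  | trans _ _ _ h _ ih ih' =>
    have := eq_of_eqvGen comp (fun _ _ ↦ Slide.comp_eq) h
    exact (ih hs (this.symm.trans hs)).trans (ih' _ _)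

end LowFactorization

/-- The factorizations of a given map `x ⟶ y` through objects of degree `< δ` are all connected
by zigzags of such factorizations. -/
def LowFactorizationsConnected (δ : Ordinal.{t}) (x y : C) : Prop :=
  ∀ s₁ s₂ : LowFactorization deg δ x y, s₁.comp = s₂.comp →
    Relation.EqvGen LowFactorization.Slide s₁ s₂

/-- A map between objects of the same degree is an identity or factors through an object of
lower degree. -/
def EqOrFactors : Prop :=
  ∀ ⦃x y : C⦄ (k : x ⟶ y), deg x = deg y → (∃ e : x = y, k = eqToHom e) ∨
    ∃ (z : C) (k₁ : x ⟶ z) (k₂ : z ⟶ y), deg z < deg x ∧ k₁ ≫ k₂ = k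

end LowFactorization

/-! ### Shapes of arrows in a collage -/

namespace BigluingData.Collage

variable {C D : Type u} [Category.{u} C] [Category.{u} D] {B : BigluingData C D}

lemma exists_rl {d : D} {c : C} (k : (right d : B.Collage) ⟶ left c) : ∃ q, k = Hom.rl q :=
  match k with
  | .rl q => ⟨q, rfl⟩

lemma exists_lr {d : D} {c : C} (k : (left c : B.Collage) ⟶ right d) : ∃ p, k = Hom.lr p :=
  match k with
  | .lr p => ⟨p, rfl⟩

lemma exists_rr_or_tensor {d d' : D} (k : (right d : B.Collage) ⟶ right d') :
    (∃ m, k = Hom.rr m) ∨ ∃ (c : C) (q : B.HomW d c) (p : B.HomU c d'),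
      k = Hom.tensor (.mk q p) := by
  match k with
  | .rr m => exact .inl ⟨m, rfl⟩
  | .tensor t =>
    obtain ⟨c, q, p, rfl⟩ := t.exists_rep
    exact .inr ⟨c, q, p, rfl⟩

end BigluingData.Collage

/-! ### Consequences of bistratification with discrete strata -/

section Bistratified

variable {C : Type u} [Category.{u} C] {deg : C → Ordinal.{t}}

/-- What bistratification with discrete strata says about the maps between objects of degree `δ`. -/
lemma IsBistratifiedDiscrete.exists_collage (h : IsBistratifiedDiscrete deg) (δ : Ordinal.{t}) :
    ∃ (I : Type u) (B : BigluingData (Below deg δ) (Discrete I)) (Ψ : B.Collage ⥤ C),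
      Ψ.Full ∧ Ψ.Faithful ∧ (∀ c, deg (Ψ.obj (.left c)) < δ) ∧
      (∀ z, deg z < δ → ∃ c, Ψ.obj (.left c) = z) ∧
      (∀ z, deg z = δ → ∃ i, Ψ.obj (.right i) = z) := by
  obtain ⟨I, B, Φ, _, _, hΦ, e⟩ := h δ
  have hl (c) : (Φ.obj (.left c)).obj = c.obj := Functor.congr_obj e c
  refine ⟨I, B, Φ ⋙ Below.ι deg (δ + 1), inferInstance, inferInstance, fun c ↦ ?_, fun z hz ↦
    ⟨⟨z, hz⟩, hl _⟩, fun z hz ↦ ?_⟩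
  · exact lt_of_eq_of_lt (congrArg deg (hl c)) c.property
  -- `Φ` is surjective on objects, and a left object has degree `< δ`, so an object of degree `δ`
  -- can only come from the right.
  · obtain ⟨c | i, hc⟩ := hΦ.2 ⟨z, by simp [degreeLT, hz]⟩
    · have h1 := hl c
      rw [hc] at h1
      have := c.property
      simp only [degreeLT, ← h1, hz, lt_self_iff_false] at this
    · exact ⟨i, by simp [hc]⟩

/-- An arrow between right objects of the collage lies either in the discrete category, where it is
an identity, or in the tensor product, where any representative is a factorization through a left
object. -/
lemma IsBistratifiedDiscrete.eqOrFactors (h : IsBistratifiedDiscrete deg) : EqOrFactors deg := by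
  intro x y k hxy
  obtain ⟨I, B, Ψ, _, _, hlt, hl, hr⟩ := h.exists_collage (deg x)
  obtain ⟨i, hi⟩ := hr x rfl
  obtain ⟨j, rfl⟩ := hr y hxy.symm
  -- The bigluing data depend on `deg x`; freeing this degree allows `x` to be replaced by `Ψ.obj
  -- (.right i)`.
  generalize hδ : deg x = δ at *
  subst hi
  obtain ⟨k, rfl⟩ := Ψ.map_surjective k
  obtain ⟨m, rfl⟩ | ⟨c, q, p, rfl⟩ := BigluingData.Collage.exists_rr_or_tensor k
  · obtain rfl : i = j := Discrete.ext (Discrete.eq_of_hom m)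
    left
    refine ⟨rfl, ?_⟩
    obtain rfl : m = 𝟙 i := Subsingleton.elim _ _
    exact Ψ.map_id (.right i)
  · right
    refine ⟨Ψ.obj (.left c), Ψ.map (.rl q), Ψ.map (.lr p), hlt c, ?_⟩
    rw [← Ψ.map_comp]
    rfl

/-- Composites through a left object lie in the tensor summand, while identities lie in the discrete
summand, and the union is disjoint. This keeps the identity and factored cases of
`StepData.exists_map` apart. -/
lemma IsBistratifiedDiscrete.comp_ne_id (h : IsBistratifiedDiscrete deg) {x z : C}
    (hz : deg z < deg x) (k₁ : x ⟶ z) (k₂ : z ⟶ x) : k₁ ≫ k₂ ≠ 𝟙 x := by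
  obtain ⟨I, B, Ψ, _, _, hlt, hl, hr⟩ := h.exists_collage (deg x)
  obtain ⟨i, hi⟩ := hr x rfl
  obtain ⟨c, rfl⟩ := hl z hz
  generalize hδ : deg x = δ at *
  subst hi
  obtain ⟨k₁, rfl⟩ := Ψ.map_surjective k₁
  obtain ⟨k₂, rfl⟩ := Ψ.map_surjective k₂
  obtain ⟨q, rfl⟩ := BigluingData.Collage.exists_rl k₁
  obtain ⟨p, rfl⟩ := BigluingData.Collage.exists_lr k₂
  intro H
  rw [← Ψ.map_comp, ← Ψ.map_id] at H
  cases Ψ.map_injective H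

/-- The tensor product embeds in the hom-sets of the collage, so factorizations with equal
composites have the same class in it, and the relation generating that quotient is a slide. -/
lemma IsBistratifiedDiscrete.connected (h : IsBistratifiedDiscrete deg) {x y : C}
    (hxy : deg x = deg y) : LowFactorizationsConnected deg (deg x) x y := by
  obtain ⟨I, B, Ψ, _, _, hlt, hl, hr⟩ := h.exists_collage (deg x)
  obtain ⟨i, hi⟩ := hr x rfl
  obtain ⟨j, rfl⟩ := hr y hxy.symm
  generalize hδ : deg x = δ at *
  subst hi
  have key (s : LowFactorization deg δ (Ψ.obj (.right i)) (Ψ.obj (.right j))) :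
      ∃ (c : Below deg δ) (q : B.HomW i c) (p : B.HomU c j),
        s = ⟨_, hlt c, Ψ.map (.rl q), Ψ.map (.lr p)⟩ := by
    obtain ⟨z, hz, k₁, k₂⟩ := s
    obtain ⟨c, rfl⟩ := hl z hz
    obtain ⟨k₁, rfl⟩ := Ψ.map_surjective k₁
    obtain ⟨k₂, rfl⟩ := Ψ.map_surjective k₂
    obtain ⟨q, rfl⟩ := BigluingData.Collage.exists_rl k₁
    obtain ⟨p, rfl⟩ := BigluingData.Collage.exists_lr k₂
    exact ⟨c, q, p, rfl⟩
  intro s s' H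
  obtain ⟨c, q, p, rfl⟩ := key s
  obtain ⟨c', q', p', rfl⟩ := key s'
  simp only [LowFactorization.comp, ← Ψ.map_comp] at H
  have H1 : BigluingData.Tensor.mk q p = BigluingData.Tensor.mk q' p' := by
    injection Ψ.map_injective H
  -- Equality in the quotient is a zigzag of `TensorRel`, which is carried to `C` one generator at a
  -- time.
  suffices ∀ a a', Relation.EqvGen (B.TensorRel i j) a a' →
      Relation.EqvGen (LowFactorization.Slide (deg := deg) (δ := δ))
        ⟨_, hlt a.1, Ψ.map (.rl a.2.1), Ψ.map (.lr a.2.2)⟩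
        ⟨_, hlt a'.1, Ψ.map (.rl a'.2.1), Ψ.map (.lr a'.2.2)⟩ from
    this _ _ (Quot.eqvGen_exact H1)
  intro a a' haa'
  induction haa' with
  | rel _ _ h =>
    obtain ⟨q, k, p⟩ := h
    refine .rel _ _ ⟨Ψ.map (.ll k), ?_, ?_⟩
    · rw [← Ψ.map_comp]; rfl
    · rw [← Ψ.map_comp]; rfl
  | refl => exact .refl _
  | symm _ _ _ ih => exact ih.symm
  | trans _ _ _ _ _ ih ih' => exact ih.trans _ _ _ ih'

end Bistratified

/-! ### Latching maps of `L`-objects -/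

section LObject

variable {D : Type u} [Category.{u} D] {deg : D → Ordinal.{t}}

lemma isEmpty_initial_obj (x : D) : IsEmpty ((⊥_ (D ⥤ Type u)).obj x) :=
  ⟨fun a ↦ PEmpty.elim
    ((initial.to ((Functor.const D).obj PEmpty.{u + 1})).app x a)⟩

/-- The initial functor has empty values, so the pushout coprojection from `L_x X` has a retraction
`r`; the latching map is this split injection followed by the injective relative latching map. -/
lemma IsReedyLObject.fromLatching_injective {X : D ⥤ Type u} (h : IsReedyLObject deg X) (x : D) :
    Function.Injective (fromLatching deg x X) := by
  have hE (y : D) := isEmpty_initial_obj y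
  let r : pushout (latchingMap deg x (initial.to X)) (fromLatching deg x (⊥_ (D ⥤ Type u))) ⟶
      latchingObj deg x X :=
    pushout.desc (𝟙 _) (↾ fun a ↦ (hE x).elim a) (by
      apply weightedColim.hom_ext
      intro c p
      ext a
      exact (hE c.obj).elim a)
  have h1 : Function.Injective (pushout.inl (latchingMap deg x (initial.to X))
      (fromLatching deg x (⊥_ (D ⥤ Type u)))) := by
    refine Function.LeftInverse.injective (g := r) fun a ↦ ?_
    have hr : pushout.inl _ _ ≫ r = 𝟙 _ := pushout.inl_desc _ _ _
    exact ConcreteCategory.congr_hom hr a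
  have hr : pushout.inl _ _ ≫ relLatching deg x (initial.to X) = fromLatching deg x X :=
    pushout.inl_desc _ _ _
  rw [← hr]
  exact fun a b hab ↦ h1 (h x hab)

end LObject

/-! ### Connected factorizations from the almost-Reedy condition -/

section AlmostReedy

variable {C : Type u} [Category.{u} C] {deg : C → Ordinal.{t}}

/-- The latching object of `C(x, -)` at `y` consists of the factorizations `x ⟶ z ⟶ y` with `deg z <
deg y` modulo zigzags, and its latching map is composition. Injectivity of that map is therefore
connectedness. -/
lemma IsAlmostReedy.connected_of_lt (h : IsAlmostReedy deg) {x y : C} (hxy : deg y < deg x) :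
    LowFactorizationsConnected deg (deg y) x y := by
  intro s s' H
  let y' : Below deg (deg x) := ⟨y, hxy⟩
  let deg' : Below deg (deg x) → Ordinal.{t} := fun y ↦ deg y.obj
  have hinj := (h.homFrom_isReedyLObject x).fromLatching_injective y'
  -- A map from the latching object to `T` that recovers the zigzag class is enough; the colimit
  -- need not be computed.
  let T := Quot (LowFactorization.Slide (deg := deg) (δ := deg y) (x := x) (y := y))
  let φ : ∀ ⦃z : Below deg' (deg' y')⦄, (homTo deg' y' (deg' y')).obj (op z) →
      ((Below.ι deg' (deg' y') ⋙ homFrom deg x (deg x)).obj z ⟶ T) :=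
    fun z k ↦ ↾ fun a ↦ Quot.mk _ ⟨z.obj.obj, z.property, a, k.hom⟩
  have hφ : ∀ ⦃z z'⦄ (m : z ⟶ z') (k : (homTo deg' y' (deg' y')).obj (op z')),
      φ ((homTo deg' y' (deg' y')).map m.op k) =
        (Below.ι deg' (deg' y') ⋙ homFrom deg x (deg x)).map m ≫ φ k := by
    intro z z' m k
    ext a
    exact Quot.sound ⟨m.hom.hom, rfl, rfl⟩
  let z (s : LowFactorization deg (deg y) x y) : Below deg' (deg' y') :=
    ⟨⟨s.mid, s.lt.trans hxy⟩, s.lt⟩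
  let k (s) : (homTo deg' y' (deg' y')).obj (op (z s)) :=
    (ObjectProperty.homMk s.snd : (z s).obj ⟶ y')
  let ι (s) : latchingObj deg' y' (homFrom deg x (deg x)) :=
    weightedColim.ι _ (Below.ι deg' (deg' y') ⋙ homFrom deg x (deg x)) (k s) s.fst
  have h1 (s) : fromLatching deg' y' (homFrom deg x (deg x)) (ι s) = s.comp :=
    ConcreteCategory.congr_hom (ι_fromLatching deg' y' (homFrom deg x (deg x))
      (y := z s) (k s)) s.fst
  have h2 (s) : weightedColim.desc _ _ φ hφ (ι s) = Quot.mk _ s :=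
    ConcreteCategory.congr_hom (weightedColim.ι_desc _ _ φ hφ (k s)) s.fst
  have h3 : ι s = ι s' := hinj ((h1 s).trans (H.trans (h1 s').symm))
  exact Quot.eqvGen_exact ((h2 s).symm.trans ((congrArg _ h3).trans (h2 s')))

/-- The same argument in the opposite category: there the objects `z` over which `C(-, y)` is
latched at `x` receive the first half of the factorization. -/
lemma IsAlmostReedy.connected_of_gt (h : IsAlmostReedy deg) {x y : C} (hxy : deg x < deg y) :
    LowFactorizationsConnected deg (deg x) x y := by
  intro s s' H
  let x' : (Below deg (deg y))ᵒᵖ := op ⟨x, hxy⟩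
  let deg' : (Below deg (deg y))ᵒᵖ → Ordinal.{t} := fun y ↦ deg y.unop.obj
  have hinj := (h.homTo_isReedyLObject y).fromLatching_injective x'
  let T := Quot (LowFactorization.Slide (deg := deg) (δ := deg x) (x := x) (y := y))
  let φ : ∀ ⦃z : Below deg' (deg' x')⦄, (homTo deg' x' (deg' x')).obj (op z) →
      ((Below.ι deg' (deg' x') ⋙ homTo deg y (deg y)).obj z ⟶ T) :=
    fun z k ↦ ↾ fun a ↦ Quot.mk _ ⟨z.obj.unop.obj, z.property, k.unop.hom, a⟩
  have hφ : ∀ ⦃z z'⦄ (m : z ⟶ z') (k : (homTo deg' x' (deg' x')).obj (op z')),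
      φ ((homTo deg' x' (deg' x')).map m.op k) =
        (Below.ι deg' (deg' x') ⋙ homTo deg y (deg y)).map m ≫ φ k := by
    intro z z' m k
    ext a
    exact (Quot.sound ⟨m.hom.unop.hom, rfl, rfl⟩).symm
  let z (s : LowFactorization deg (deg x) x y) : Below deg' (deg' x') :=
    ⟨op ⟨s.mid, s.lt.trans hxy⟩, s.lt⟩
  let k (s) : (homTo deg' x' (deg' x')).obj (op (z s)) :=
    (ObjectProperty.homMk s.fst : x'.unop ⟶ (z s).obj.unop).op
  let ι (s) : latchingObj deg' x' (homTo deg y (deg y)) :=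
    weightedColim.ι _ (Below.ι deg' (deg' x') ⋙ homTo deg y (deg y)) (k s) s.snd
  have h1 (s) : fromLatching deg' x' (homTo deg y (deg y)) (ι s) = s.comp :=
    ConcreteCategory.congr_hom (ι_fromLatching deg' x' (homTo deg y (deg y))
      (y := z s) (k s)) s.snd
  have h2 (s) : weightedColim.desc _ _ φ hφ (ι s) = Quot.mk _ s :=
    ConcreteCategory.congr_hom (weightedColim.ι_desc _ _ φ hφ (k s)) s.snd
  have h3 : ι s = ι s' := hinj ((h1 s).trans (H.trans (h1 s').symm))
  exact Quot.eqvGen_exact ((h2 s).symm.trans ((congrArg _ h3).trans (h2 s')))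

end AlmostReedy

/-! ### Lifting properties of relative weighted colimits and limits -/

section RelativeWeighted

variable {D : Type u} [Category.{u} D] {M : Type w} [Category.{v} M]

lemma weightedColim.ι_w [HasColimitsOfSize.{u, u} M] (U : Dᵒᵖ ⥤ Type u) (X : D ⥤ M) {c c' : D}
    (k : c ⟶ c') (p : U.obj (op c')) :
    X.map k ≫ weightedColim.ι U X p = weightedColim.ι U X (U.map k.op p) :=
  colimit.w ((CategoryOfElements.π U).leftOp ⋙ X)
    (Quiver.Hom.op (CategoryOfElements.homMk (U.elementsMk (op c') p)
      (U.elementsMk (op c) (U.map k.op p)) k.op rfl))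

/-- The left lifting property for a map out of a relative weighted colimit
`(U ⊗ B) ⊔_{U ⊗ A} X`, in terms of the coprojections of the weighted colimit. -/
lemma llp_pushout_weightedColim_iff [HasColimitsOfSize.{u, u} M] [HasPushouts M]
    (R : MorphismProperty M) (U : Dᵒᵖ ⥤ Type u) {A B : D ⥤ M} (f : A ⟶ B) {X Q : M}
    (α : weightedColim U A ⟶ X) (j : pushout (weightedColim.map U f) α ⟶ Q) :
    R.llp j ↔ ∀ ⦃Y Z : M⦄ (p : Y ⟶ Z), R p → ∀ (a : X ⟶ Y) (b : Q ⟶ Z)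
      (φ : ∀ ⦃d : D⦄, U.obj (op d) → (B.obj d ⟶ Y)),
      a ≫ p = (pushout.inr _ _ ≫ j) ≫ b →
      (∀ ⦃d⦄ (u : U.obj (op d)), f.app d ≫ φ u = (weightedColim.ι U A u ≫ α) ≫ a) →
      (∀ ⦃d⦄ (u : U.obj (op d)),
        φ u ≫ p = (weightedColim.ι U B u ≫ pushout.inl _ _ ≫ j) ≫ b) →
      (∀ ⦃d d'⦄ (m : d ⟶ d') (u : U.obj (op d')), B.map m ≫ φ u = φ (U.map m.op u)) →
      ∃ l : Q ⟶ Y, (pushout.inr _ _ ≫ j) ≫ l = a ∧ l ≫ p = b ∧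
        ∀ ⦃d⦄ (u : U.obj (op d)), (weightedColim.ι U B u ≫ pushout.inl _ _ ≫ j) ≫ l = φ u := by
  constructor
  · intro H Y Z p hp a b φ h₁ h₂ h₃ h₄
    have := H p hp
    let φ' : weightedColim U B ⟶ Y := weightedColim.desc U B φ fun _ _ m u ↦ (h₄ m u).symm
    have hφ' {d} (u : U.obj (op d)) : weightedColim.ι U B u ≫ φ' = φ u :=
      weightedColim.ι_desc _ _ _ _ _
    have e : weightedColim.map U f ≫ φ' = α ≫ a := by
      apply weightedColim.hom_ext
      intro d u
      rw [← Category.assoc, weightedColim.ι_map, Category.assoc, hφ', h₂, Category.assoc]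
    have sq : CommSq (pushout.desc φ' a e) j p b := ⟨by
      apply pushout.hom_ext
      · rw [← Category.assoc, pushout.inl_desc]
        apply weightedColim.hom_ext
        intro d u
        rw [← Category.assoc, hφ', h₃]
        simp only [Category.assoc]
      · rw [← Category.assoc, pushout.inr_desc, h₁, Category.assoc]⟩
    refine ⟨sq.lift, ?_, sq.fac_right, fun d u ↦ ?_⟩
    · rw [Category.assoc, sq.fac_left, pushout.inr_desc]
    · rw [Category.assoc, Category.assoc, sq.fac_left, pushout.inl_desc, hφ']
  · intro H Y Z p hp
    refine ⟨fun {g b} sq ↦ ?_⟩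
    obtain ⟨l, h₁, h₂, h₃⟩ := H p hp (pushout.inr _ _ ≫ g) b
      (fun d u ↦ weightedColim.ι U B u ≫ pushout.inl _ _ ≫ g) (by simp [sq.w])
      (fun d u ↦ by
        rw [← Category.assoc, ← weightedColim.ι_map]
        simp only [Category.assoc]
        rw [pushout.condition_assoc])
      (fun d u ↦ by simp [sq.w])
      (fun d d' m u ↦ by rw [← Category.assoc, weightedColim.ι_w])
    refine ⟨⟨⟨l, ?_, h₂⟩⟩⟩
    apply pushout.hom_ext
    · apply weightedColim.hom_ext
      intro d u
      simpa using h₃ u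
    · simpa using h₁

/-- The right lifting property for a map into a relative weighted limit
`{W, A} ×_{W, B} X`, in terms of the projections of the weighted limit. -/
lemma rlp_pullback_weightedLim_iff [HasLimitsOfSize.{u, u} M] [HasPullbacks M]
    (L : MorphismProperty M) (W : D ⥤ Type u) {A B : D ⥤ M} (f : A ⟶ B) {X Q : M}
    (α : X ⟶ W.weightedLimObjObj B) (j : Q ⟶ pullback (W.weightedLimObjMap f) α) :
    L.rlp j ↔ ∀ ⦃Y Z : M⦄ (i : Y ⟶ Z), L i → ∀ (a : Y ⟶ Q) (b : Z ⟶ X)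
      (φ : ∀ ⦃d : D⦄, W.obj d → (Z ⟶ A.obj d)),
      a ≫ j ≫ pullback.snd _ _ = i ≫ b →
      (∀ ⦃d⦄ (u : W.obj d), φ u ≫ f.app d = b ≫ α ≫ W.weightedLimObjObjπ B u) →
      (∀ ⦃d⦄ (u : W.obj d),
        i ≫ φ u = a ≫ j ≫ pullback.fst _ _ ≫ W.weightedLimObjObjπ A u) →
      (∀ ⦃d d'⦄ (m : d ⟶ d') (u : W.obj d), φ u ≫ A.map m = φ (W.map m u)) →
      ∃ l : Z ⟶ Q, l ≫ j ≫ pullback.snd _ _ = b ∧ i ≫ l = a ∧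
        ∀ ⦃d⦄ (u : W.obj d), l ≫ j ≫ pullback.fst _ _ ≫ W.weightedLimObjObjπ A u = φ u := by
  constructor
  · intro H Y Z i hi a b φ h₁ h₂ h₃ h₄
    have := H i hi
    let φ' : Z ⟶ W.weightedLimObjObj A := (W.isLimitWeightedLimCone A).lift
      (fun _ u ↦ φ u) (fun _ _ u m ↦ h₄ m u)
    have hφ' {d} (u : W.obj d) : φ' ≫ W.weightedLimObjObjπ A u = φ u :=
      W.isLimitWeightedLimCone_fac A _ _ u
    have e : φ' ≫ W.weightedLimObjMap f = b ≫ α := by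
      apply Functor.weightedLimObjObj.hom_ext
      intro d u
      rw [Category.assoc, Functor.weightedLimObjMap_π, ← Category.assoc, hφ', h₂, Category.assoc]
    have sq : CommSq a i j (pullback.lift φ' b e) := ⟨by
      apply pullback.hom_ext
      · simp only [Category.assoc, pullback.lift_fst]
        apply Functor.weightedLimObjObj.hom_ext
        intro d u
        simp only [Category.assoc, hφ', h₃]
      · simp only [Category.assoc, pullback.lift_snd, h₁]⟩
    refine ⟨sq.lift, ?_, sq.fac_left, fun d u ↦ ?_⟩
    · rw [← Category.assoc, sq.fac_right, pullback.lift_snd]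
    · rw [← Category.assoc, sq.fac_right, ← Category.assoc, pullback.lift_fst, hφ']
  · intro H Y Z i hi
    refine ⟨fun {a g} sq ↦ ?_⟩
    have w := sq.w
    obtain ⟨l, h₁, h₂, h₃⟩ := H i hi a (g ≫ pullback.snd _ _)
      (fun d u ↦ g ≫ pullback.fst _ _ ≫ W.weightedLimObjObjπ A u)
      (by rw [reassoc_of% w])
      (fun d u ↦ by
        simp only [Category.assoc, ← Functor.weightedLimObjMap_π]
        rw [pullback.condition_assoc])
      (fun d u ↦ by rw [reassoc_of% w])
      (fun d d' m u ↦ by simp)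
    refine ⟨⟨⟨l, h₂, ?_⟩⟩⟩
    apply pullback.hom_ext
    · apply Functor.weightedLimObjObj.hom_ext
      intro d u
      simpa using h₃ u
    · simpa using h₁

end RelativeWeighted

/-! ### Lifting properties of relative latching and matching maps -/

section Lifting

variable {C : Type u} [Category.{u} C] (deg : C → Ordinal.{t}) {M : Type w} [Category.{v} M]

/-- The left lifting property of the relative latching map of `f` at `x` with respect to `R`,
expressed without latching objects: a map from the latching object `L_x B` is a compatible
family of maps from the `B y`, for `y ⟶ x` with `y` of lower degree. -/
def LatchingLifts (R : MorphismProperty M) {A B : C ⥤ M} (f : A ⟶ B) (x : C) : Prop :=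
  ∀ ⦃Y Z : M⦄ (p : Y ⟶ Z), R p → ∀ (a : A.obj x ⟶ Y) (b : B.obj x ⟶ Z)
    (φ : ∀ (y : C) (_ : y ⟶ x) (_ : deg y < deg x), B.obj y ⟶ Y),
    a ≫ p = f.app x ≫ b →
    (∀ y k h, f.app y ≫ φ y k h = A.map k ≫ a) →
    (∀ y k h, φ y k h ≫ p = B.map k ≫ b) →
    (∀ y y' (m : y ⟶ y') k h h', B.map m ≫ φ y' k h' = φ y (m ≫ k) h) →
    ∃ l : B.obj x ⟶ Y, f.app x ≫ l = a ∧ l ≫ p = b ∧ ∀ y k h, B.map k ≫ l = φ y k h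

/-- The right lifting property of the relative matching map of `f` at `x` with respect to `L`,
expressed without matching objects. -/
def MatchingLifts (L : MorphismProperty M) {A B : C ⥤ M} (f : A ⟶ B) (x : C) : Prop :=
  ∀ ⦃Y Z : M⦄ (i : Y ⟶ Z), L i → ∀ (a : Y ⟶ A.obj x) (b : Z ⟶ B.obj x)
    (φ : ∀ (y : C) (_ : x ⟶ y) (_ : deg y < deg x), Z ⟶ A.obj y),
    a ≫ f.app x = i ≫ b →
    (∀ y k h, φ y k h ≫ f.app y = b ≫ B.map k) →
    (∀ y k h, i ≫ φ y k h = a ≫ A.map k) →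
    (∀ y y' (m : y ⟶ y') k h h', φ y k h ≫ A.map m = φ y' (k ≫ m) h') →
    ∃ l : Z ⟶ A.obj x, l ≫ f.app x = b ∧ i ≫ l = a ∧ ∀ y k h, l ≫ A.map k = φ y k h

variable {deg}

/-- This trades the colimit for compatible families. In that form the condition can be compared
across degree bounds, passed to `LowOver`, and checked on retracts by a formula. -/
lemma llp_relLatching_iff [HasColimitsOfSize.{u, u} M] [HasPushouts M] (R : MorphismProperty M)
    {A B : C ⥤ M} (f : A ⟶ B) (x : C) :
    R.llp (relLatching deg x f) ↔ LatchingLifts deg R f x := by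
  refine (llp_pushout_weightedColim_iff R _ _ _ (relLatching deg x f)).trans ?_
  have h₁ : pushout.inr _ _ ≫ relLatching deg x f = f.app x := pushout.inr_desc _ _ _
  have h₂ : pushout.inl _ _ ≫ relLatching deg x f = fromLatching deg x B := pushout.inl_desc _ _ _
  have h₃ {d : Below deg (deg x)} (u : d.obj ⟶ x) := ι_fromLatching deg x A u
  have h₄ {d : Below deg (deg x)} (u : d.obj ⟶ x) := ι_fromLatching deg x B u
  constructor
  · intro H Y Z p hp a b φ e₁ e₂ e₃ e₄
    obtain ⟨l, hl₁, hl₂, hl₃⟩ := H p hp a b (fun y k ↦ φ y.obj k y.property)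
      (e₁.trans (h₁ =≫ b).symm) (fun y k ↦ (e₂ _ _ y.property).trans (h₃ k =≫ a).symm)
      (fun y k ↦ (e₃ _ _ y.property).trans
        (((_ ≫= h₂).trans (h₄ k)) =≫ b).symm)
      (fun y y' m k ↦ e₄ _ _ m.hom k y.property y'.property)
    exact ⟨l, (h₁ =≫ l).symm.trans hl₁, hl₂, fun y k h ↦
      (((_ ≫= h₂).trans (h₄ (d := ⟨y, h⟩) k)) =≫ l).symm.trans (hl₃ (d := ⟨y, h⟩) k)⟩
  · intro H Y Z p hp a b φ e₁ e₂ e₃ e₄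
    obtain ⟨l, hl₁, hl₂, hl₃⟩ := H p hp a b (fun y k h ↦ φ (d := ⟨y, h⟩) k)
      (e₁.trans (h₁ =≫ b)) (fun y k h ↦ (e₂ (d := ⟨y, h⟩) k).trans (h₃ (d := ⟨y, h⟩) k =≫ a))
      (fun y k h ↦ (e₃ (d := ⟨y, h⟩) k).trans (((_ ≫= h₂).trans (h₄ (d := ⟨y, h⟩) k)) =≫ b))
      (fun y y' m k h h' ↦ e₄ (d := ⟨y, h⟩) (d' := ⟨y', h'⟩) (ObjectProperty.homMk m) k)
    exact ⟨l, (h₁ =≫ l).trans hl₁, hl₂, fun y k ↦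
      (((_ ≫= h₂).trans (h₄ k)) =≫ l).trans (hl₃ _ k y.property)⟩

lemma rlp_relMatching_iff [HasLimitsOfSize.{u, u} M] [HasPullbacks M] (L : MorphismProperty M)
    {A B : C ⥤ M} (f : A ⟶ B) (x : C) :
    L.rlp (relMatching deg x f) ↔ MatchingLifts deg L f x := by
  refine (rlp_pullback_weightedLim_iff L _ _ _ (relMatching deg x f)).trans ?_
  have h₁ : relMatching deg x f ≫ pullback.snd _ _ = f.app x := pullback.lift_snd _ _ _
  have h₂ : relMatching deg x f ≫ pullback.fst _ _ = toMatching deg x A := pullback.lift_fst _ _ _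
  have h₃ {d : Below deg (deg x)} (u : x ⟶ d.obj) := toMatching_π deg x B u
  have h₄ {d : Below deg (deg x)} (u : x ⟶ d.obj) : relMatching deg x f ≫ pullback.fst _ _ ≫
      (homFrom deg x (deg x)).weightedLimObjObjπ (Below.ι deg (deg x) ⋙ A) (j := d) u = A.map u :=
    (Category.assoc _ _ _).symm.trans ((h₂ =≫ _).trans (toMatching_π deg x A u))
  constructor
  · intro H Y Z i hi a b φ e₁ e₂ e₃ e₄
    obtain ⟨l, hl₁, hl₂, hl₃⟩ := H i hi a b (fun y k ↦ φ y.obj k y.property)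
      ((a ≫= h₁).trans e₁) (fun y k ↦ (e₂ _ _ y.property).trans (b ≫= h₃ k).symm)
      (fun y k ↦ (e₃ _ _ y.property).trans (a ≫= h₄ k).symm)
      (fun y y' m k ↦ e₄ _ _ m.hom k y.property y'.property)
    exact ⟨l, (l ≫= h₁).symm.trans hl₁, hl₂, fun y k h ↦
      (l ≫= h₄ (d := ⟨y, h⟩) k).symm.trans (hl₃ (d := ⟨y, h⟩) k)⟩
  · intro H Y Z i hi a b φ e₁ e₂ e₃ e₄
    obtain ⟨l, hl₁, hl₂, hl₃⟩ := H i hi a b (fun y k h ↦ φ (d := ⟨y, h⟩) k)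
      ((a ≫= h₁).symm.trans e₁) (fun y k h ↦ (e₂ (d := ⟨y, h⟩) k).trans (b ≫= h₃ (d := ⟨y, h⟩) k))
      (fun y k h ↦ (e₃ (d := ⟨y, h⟩) k).trans (a ≫= h₄ (d := ⟨y, h⟩) k))
      (fun y y' m k h h' ↦ e₄ (d := ⟨y, h⟩) (d' := ⟨y', h'⟩) (ObjectProperty.homMk m) k)
    exact ⟨l, (l ≫= h₁).trans hl₁, hl₂, fun y k ↦ (l ≫= h₄ k).trans (hl₃ _ k y.property)⟩

/-- The four natural transformations in a retract of arrows of functors. -/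
lemma exists_natTrans_of_retractArrow {A B A' B' : C ⥤ M} {f : A ⟶ B} {f' : A' ⟶ B'}
    (r : RetractArrow f f') :
    ∃ (iA : A ⟶ A') (iB : B ⟶ B') (rA : A' ⟶ A) (rB : B' ⟶ B),
      (∀ y, f'.app y ≫ rB.app y = rA.app y ≫ f.app y) ∧
      (∀ y, f.app y ≫ iB.app y = iA.app y ≫ f'.app y) ∧
      (∀ y, iA.app y ≫ rA.app y = 𝟙 _) ∧ (∀ y, iB.app y ≫ rB.app y = 𝟙 _) :=
  ⟨r.i.left, r.i.right, r.r.left, r.r.right, fun y ↦ (congr_app r.r.w y).symm,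
    fun y ↦ (congr_app r.i.w y).symm, fun y ↦ congr_app r.left.retract y,
    fun y ↦ congr_app r.right.retract y⟩

/-- Extend the lifting problem to `f'` along the retraction, solve it there, and restrict the
solution along the section. -/
lemma LatchingLifts.of_retract {R : MorphismProperty M} {A B A' B' : C ⥤ M} {f : A ⟶ B}
    {f' : A' ⟶ B'} (r : RetractArrow f f') {x : C} (H : LatchingLifts deg R f' x) :
    LatchingLifts deg R f x := by
  intro Y Z p hp a b φ h₁ h₂ h₃ h₄
  obtain ⟨iA, iB, rA, rB, wr, wi, rl, rr⟩ := exists_natTrans_of_retractArrow r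
  obtain ⟨l, e₁, e₂, e₃⟩ := H p hp (rA.app x ≫ a) (rB.app x ≫ b)
    (fun y k h ↦ rB.app y ≫ φ y k h)
    (by rw [Category.assoc, h₁, ← reassoc_of% wr])
    (fun y k h ↦ by rw [reassoc_of% wr, h₂, NatTrans.naturality_assoc])
    (fun y k h ↦ by rw [Category.assoc, h₃, NatTrans.naturality_assoc])
    (fun y y' m k h h' ↦ by rw [NatTrans.naturality_assoc, h₄ _ _ _ _ h])
  refine ⟨iB.app x ≫ l, ?_, ?_, fun y k h ↦ ?_⟩
  · rw [reassoc_of% wi, e₁, reassoc_of% rl]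
  · rw [Category.assoc, e₂, reassoc_of% rr]
  · rw [NatTrans.naturality_assoc, e₃ y k h, reassoc_of% rr]

lemma MatchingLifts.of_retract {L : MorphismProperty M} {A B A' B' : C ⥤ M} {f : A ⟶ B}
    {f' : A' ⟶ B'} (r : RetractArrow f f') {x : C} (H : MatchingLifts deg L f' x) :
    MatchingLifts deg L f x := by
  intro Y Z i hi a b φ h₁ h₂ h₃ h₄
  obtain ⟨iA, iB, rA, rB, wr, wi, rl, rr⟩ := exists_natTrans_of_retractArrow r
  obtain ⟨l, e₁, e₂, e₃⟩ := H i hi (a ≫ iA.app x) (b ≫ iB.app x)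
    (fun y k h ↦ φ y k h ≫ iA.app y)
    (by rw [Category.assoc, ← wi, reassoc_of% h₁])
    (fun y k h ↦ by
      rw [Category.assoc, ← wi, reassoc_of% (h₂ y k h), Category.assoc, NatTrans.naturality])
    (fun y k h ↦ by rw [reassoc_of% (h₃ y k h), Category.assoc, NatTrans.naturality])
    (fun y y' m k h h' ↦ by
      rw [Category.assoc, ← NatTrans.naturality, reassoc_of% (h₄ _ _ m k h h')])
  refine ⟨l ≫ rA.app x, ?_, ?_, fun y k h ↦ ?_⟩
  · rw [Category.assoc, ← wr, reassoc_of% e₁, rr, Category.comp_id]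
  · rw [reassoc_of% e₂, rl, Category.comp_id]
  · rw [Category.assoc, ← NatTrans.naturality, reassoc_of% (e₃ y k h), rl, Category.comp_id]

end Lifting

/-! ### Transfinite recursion by extension and gluing -/

/-- Transfinite construction of a global section: `F` is a presheaf on the subsets of a well-order
such that compatible families over initial segments glue uniquely, and sections over `Iio δ` extend
to sections over `Iic δ` satisfying `P δ`. -/
lemma exists_section_of_extensions {J : Type*} [LinearOrder J] [WellFoundedLT J]
    {F : Set J → Type*} (res : ∀ {S T : Set J}, S ⊆ T → F T → F S)
    (res_refl : ∀ {S} (s : F S), res subset_rfl s = s)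
    (res_res : ∀ {S T U} (h : S ⊆ T) (h' : T ⊆ U) (s : F U), res h (res h' s) = res (h.trans h') s)
    (glue : ∀ (T : Set J) (hT : ∀ γ ∈ T, Set.Iic γ ⊆ T) (s : ∀ γ ∈ T, F (Set.Iic γ)),
      (∀ γ γ' (h : γ ∈ T) (h' : γ' ∈ T) (hle : γ ≤ γ'),
        res (Set.Iic_subset_Iic.2 hle) (s γ' h') = s γ h) →
      ∃! t : F T, ∀ γ h, res (hT γ h) t = s γ h)
    (P : ∀ δ, F (Set.Iic δ) → Prop)
    (ext : ∀ δ (s : F (Set.Iio δ)), ∃ t : F (Set.Iic δ),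
      res Set.Iio_subset_Iic_self t = s ∧ P δ t) :
    ∃ t : F Set.univ, ∀ δ, P δ (res (Set.subset_univ _) t) := by
  choose E hE hP using ext
  -- Good sections follow the chosen extension `E` at every stage, hence are unique over each `Iic
  -- δ`. Uniqueness supplies the compatibility that `glue` demands.
  let Good (δ : J) (t : F (Set.Iic δ)) : Prop := ∀ γ (h : γ ≤ δ),
    res (Set.Iic_subset_Iic.2 h) t = E γ (res (Set.Iio_subset_Iic_self.trans
      (Set.Iic_subset_Iic.2 h)) t)
  have good_res {δ γ} (h : γ ≤ δ) {t} (ht : Good δ t) :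
      Good γ (res (Set.Iic_subset_Iic.2 h) t) := fun γ' h' ↦ by
    rw [res_res, res_res, ht γ' (h'.trans h)]
  have main : ∀ δ, ∃! t, Good δ t := by
    intro δ
    induction δ using WellFoundedLT.induction with
    | ind δ ih =>
      choose s hs hs' using ih
      dsimp at hs'
      have hlow : ∀ γ ∈ Set.Iio δ, Set.Iic γ ⊆ Set.Iio δ := fun γ h γ' h' ↦ lt_of_le_of_lt h' h
      obtain ⟨t₀, ht₀, ht₀'⟩ := glue (Set.Iio δ) hlow (fun γ h ↦ s γ h)
        (fun γ γ' h h' hle ↦ hs' γ h _ (good_res hle (hs γ' h')))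
      refine ⟨E δ t₀, fun γ h ↦ ?_, fun t' ht' ↦ ?_⟩
      · obtain rfl | h := h.eq_or_lt
        · rw [res_refl, hE]
        · have h1 : res (Set.Iic_subset_Iic.2 h.le) (E δ t₀) = s γ h := by
            rw [← ht₀ γ h, ← hE δ t₀, res_res, hE]
          have h2 := hs γ h γ le_rfl
          rw [res_refl] at h2
          rw [h1, h2, ← h1, res_res]
      · have h1 := ht' δ le_rfl
        rw [res_refl] at h1
        rw [h1]
        congr 1
        refine ht₀' _ fun γ h ↦ ?_
        rw [res_res]
        exact hs' γ h _ (good_res (le_of_lt h) ht')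
  choose s hs hs' using main
  dsimp at hs'
  obtain ⟨t, ht, -⟩ := glue Set.univ (fun _ _ ↦ Set.subset_univ _) (fun γ _ ↦ s γ)
    (fun γ γ' h h' hle ↦ hs' γ _ (good_res hle (hs γ')))
  refine ⟨t, fun δ ↦ ?_⟩
  have h2 := hs δ δ le_rfl
  rw [res_refl] at h2
  rw [ht δ trivial, h2]
  exact hP _ _

lemma mem_Iic_total {J : Type*} [LinearOrder J] (a b : J) : a ∈ Set.Iic b ∨ b ∈ Set.Iic a :=
  le_total a b

lemma mem_Iio_or_eq {J : Type*} [LinearOrder J] {a b : J} (h : a ∈ Set.Iic b) :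
    a ∈ Set.Iio b ∨ a = b :=
  lt_or_eq_of_le (Set.mem_Iic.1 h)

/-! ### The lifting theorem -/

section LiftingTheorem

variable {C : Type u} [Category.{u} C] {deg : C → Ordinal.{t}} {M : Type w} [Category.{v} M]

/-- A lift at `x` extending given maps on the objects of lower degree. -/
lemma LatchingLifts.exists_lift [HasLimitsOfSize.{u, u} M] [HasPullbacks M]
    {R : MorphismProperty M} {A B X Y : C ⥤ M}
    {f : A ⟶ B} {p : X ⟶ Y} {x : C} (hf : LatchingLifts deg R f x) (hp : R (relMatching deg x p))
    (a : A.obj x ⟶ X.obj x) (b : B.obj x ⟶ Y.obj x) (e : a ≫ p.app x = f.app x ≫ b)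
    (φ : ∀ (y : C) (_ : y ⟶ x) (_ : deg y < deg x), B.obj y ⟶ X.obj x)
    (ψ : ∀ (y : C) (_ : x ⟶ y) (_ : deg y < deg x), B.obj x ⟶ X.obj y)
    (hφ₁ : ∀ y k h, f.app y ≫ φ y k h = A.map k ≫ a)
    (hφ₂ : ∀ y k h, φ y k h ≫ p.app x = B.map k ≫ b)
    (hφ₃ : ∀ y y' (m : y ⟶ y') k h h', B.map m ≫ φ y' k h' = φ y (m ≫ k) h)
    (hψ₁ : ∀ y k h, ψ y k h ≫ p.app y = b ≫ Y.map k)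
    (hψ₂ : ∀ y k h, f.app x ≫ ψ y k h = a ≫ X.map k)
    (hψ₃ : ∀ y y' (m : y ⟶ y') k h h', ψ y k h ≫ X.map m = ψ y' (k ≫ m) h')
    (hφψ : ∀ y y' k k' h h', B.map k ≫ ψ y' k' h' = φ y k h ≫ X.map k') :
    ∃ l : B.obj x ⟶ X.obj x, f.app x ≫ l = a ∧ l ≫ p.app x = b ∧
      (∀ y k h, B.map k ≫ l = φ y k h) ∧ (∀ y k h, l ≫ X.map k = ψ y k h) := by
  let ψ' : B.obj x ⟶ matchingObj deg x X :=
    ((homFrom deg x (deg x)).isLimitWeightedLimCone (Below.ι deg (deg x) ⋙ X)).lift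
      (fun y k ↦ ψ y.obj k y.property) (fun y y' k m ↦ hψ₃ _ _ m.hom k y.property y'.property)
  have hψ₀ (y : Below deg (deg x)) (k : x ⟶ y.obj) : ψ' ≫
      (homFrom deg x (deg x)).weightedLimObjObjπ (Below.ι deg (deg x) ⋙ X) (j := y) k =
        ψ y.obj k y.property :=
    Functor.isLimitWeightedLimCone_fac (homFrom deg x (deg x)) (Below.ι deg (deg x) ⋙ X) _ _
      (j := y) k
  have h₀ (Z : C ⥤ M) (y : Below deg (deg x)) (k : x ⟶ y.obj) := toMatching_π deg x Z k
  have e' : ψ' ≫ matchingMap deg x p = b ≫ toMatching deg x Y := by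
    apply Functor.weightedLimObjObj.hom_ext
    intro y k
    rw [matchingMap, Category.assoc, Category.assoc, Functor.weightedLimObjMap_π,
      reassoc_of% (hψ₀ y k), h₀]
    exact hψ₁ _ _ _
  have r₁ : relMatching deg x p ≫ pullback.fst _ _ = toMatching deg x X := pullback.lift_fst _ _ _
  have r₂ : relMatching deg x p ≫ pullback.snd _ _ = p.app x := pullback.lift_snd _ _ _
  -- Lifting against the relative matching map meets both requirements at once: `φ` is the part on
  -- the latching object, and `ψ` sits in the bottom of the square. The hypothesis `hφψ` makes that
  -- square commute on the latching object.
  obtain ⟨l, h₁, h₂, h₃⟩ := hf (relMatching deg x p) hp a (pullback.lift ψ' b e') φ (by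
      apply pullback.hom_ext
      · rw [Category.assoc, r₁, Category.assoc, pullback.lift_fst]
        apply Functor.weightedLimObjObj.hom_ext
        intro y k
        rw [Category.assoc, h₀, Category.assoc, hψ₀]
        exact (hψ₂ _ _ _).symm
      · rw [Category.assoc, r₂, Category.assoc, pullback.lift_snd, e]) hφ₁ (fun y k h ↦ by
      apply pullback.hom_ext
      · rw [Category.assoc, r₁, Category.assoc, pullback.lift_fst]
        apply Functor.weightedLimObjObj.hom_ext
        intro y' k'
        rw [Category.assoc, h₀, Category.assoc, hψ₀]
        exact (hφψ _ _ _ _ _ _).symm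
      · rw [Category.assoc, r₂, Category.assoc, pullback.lift_snd, hφ₂]) hφ₃
  refine ⟨l, h₁, ?_, h₃, fun y k h ↦ ?_⟩
  · rw [← r₂, reassoc_of% h₂, pullback.lift_snd]
  · rw [← h₀ X ⟨y, h⟩ k, ← r₁]
    simp only [Category.assoc]
    rw [reassoc_of% h₂, pullback.lift_fst_assoc, hψ₀]

/-- The lifts in a square of natural transformations, on the objects of degree in `S`. -/
structure PartialLift (deg : C → Ordinal.{t}) {A B X Y : C ⥤ M} (f : A ⟶ B) (p : X ⟶ Y)
    (a : A ⟶ X) (b : B ⟶ Y) (S : Set Ordinal.{t}) where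
  app (x : C) (h : deg x ∈ S) : B.obj x ⟶ X.obj x
  naturality {x y : C} (hx : deg x ∈ S) (hy : deg y ∈ S) (k : x ⟶ y) :
    B.map k ≫ app y hy = app x hx ≫ X.map k
  fac_left (x : C) (h : deg x ∈ S) : f.app x ≫ app x h = a.app x
  fac_right (x : C) (h : deg x ∈ S) : app x h ≫ p.app x = b.app x

attribute [ext] PartialLift

/-- Induction on the degree. Only `EqOrFactors` is asked of the indexing category, so the result
also applies to `LowOver` and `LowUnder`, which need not be bistratified. -/
lemma hasLiftingProperty_of_latchingLifts [HasLimitsOfSize.{u, u} M] [HasPullbacks M]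
    (hC : EqOrFactors deg)
    {R : MorphismProperty M} {A B X Y : C ⥤ M} {f : A ⟶ B} {p : X ⟶ Y}
    (hf : ∀ x, LatchingLifts deg R f x) (hp : ∀ x, R (relMatching deg x p)) :
    HasLiftingProperty f p := by
  refine ⟨fun {a b} sq ↦ ?_⟩
  -- The lifting conditions are part of `PartialLift`, so the predicate carried through the
  -- recursion is trivial.
  suffices ∃ l : PartialLift deg f p a b Set.univ, ∀ δ : Ordinal.{t}, True by
    obtain ⟨l, -⟩ := this
    exact ⟨⟨⟨⟨fun x ↦ l.app x trivial, fun _ _ k ↦ l.naturality _ _ k⟩, by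
      ext x; exact l.fac_left x _, by ext x; exact l.fac_right x _⟩⟩⟩
  refine exists_section_of_extensions (F := PartialLift deg f p a b)
    (fun h s ↦ ⟨fun x hx ↦ s.app x (h hx), fun _ _ k ↦ s.naturality _ _ k,
      fun _ _ ↦ s.fac_left _ _, fun _ _ ↦ s.fac_right _ _⟩) (fun _ ↦ rfl) (fun _ _ _ ↦ rfl)
    (fun T hT s hs ↦ ?_) (fun _ _ ↦ True) (fun δ s ↦ ?_)
  · have key (x) {γ} (hx : deg x ∈ T) (hγ : γ ∈ T) (h : deg x ∈ Set.Iic γ) :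
        (s γ hγ).app x h = (s (deg x) hx).app x Set.self_mem_Iic :=
      congrFun (congrFun (congrArg PartialLift.app (hs _ _ hx hγ h)) x) Set.self_mem_Iic
    refine ⟨⟨fun x hx ↦ (s (deg x) hx).app x Set.self_mem_Iic, fun {x y} hx hy k ↦ ?_,
      fun x hx ↦ (s _ _).fac_left _ _, fun x hx ↦ (s _ _).fac_right _ _⟩, fun γ hγ ↦ ?_,
      fun t ht ↦ ?_⟩
    · obtain h | h := mem_Iic_total (deg x) (deg y)
      · rw [← key x hx hy h, (s _ hy).naturality]
      · rw [← key y hy hx h, (s _ hx).naturality]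
    · ext x hx
      exact (key x (hT γ hγ hx) hγ hx).symm
    · ext x hx
      exact congrFun (congrFun (congrArg PartialLift.app (ht _ hx)) x) Set.self_mem_Iic
  · have mem {x y : C} (hx : deg x = δ) (h : deg y < deg x) : deg y ∈ Set.Iio δ :=
      h.trans_eq hx
    have step (x : C) (hx : deg x = δ) := (hf x).exists_lift (hp x) (a.app x) (b.app x)
      (congr_app sq.w x)
      (fun y k h ↦ s.app y (mem hx h) ≫ X.map k)
      (fun y k h ↦ B.map k ≫ s.app y (mem hx h))
      (fun y k h ↦ by rw [← Category.assoc, s.fac_left, a.naturality])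
      (fun y k h ↦ by rw [Category.assoc, p.naturality, ← Category.assoc, s.fac_right,
        b.naturality])
      (fun y y' m k h h' ↦ by
        rw [← Category.assoc, s.naturality (mem hx h), Category.assoc, X.map_comp])
      (fun y k h ↦ by rw [Category.assoc, s.fac_right, b.naturality])
      (fun y k h ↦ by rw [← f.naturality_assoc, s.fac_left, a.naturality])
      (fun y y' m k h h' ↦ by
        rw [Category.assoc, ← s.naturality _ (mem hx h'), B.map_comp, Category.assoc])
      (fun y y' k k' h h' ↦ by
        rw [Category.assoc, ← X.map_comp, ← s.naturality _ (mem hx h'), B.map_comp,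
          Category.assoc])
    choose l hl₁ hl₂ hl₃ hl₄ using step
    classical
    let app (x : C) (h : deg x ∈ Set.Iic δ) : B.obj x ⟶ X.obj x :=
      if h' : deg x ∈ Set.Iio δ then s.app x h' else l x (le_antisymm h (not_lt.1 h'))
    have app_lt (x : C) (h : deg x ∈ Set.Iio δ) (h') : app x h' = s.app x h := dif_pos h
    have app_eq (x : C) (h : deg x = δ) (h') : app x h' = l x h := dif_neg h.not_lt
    refine ⟨⟨app, fun {x y} hx' hy' k ↦ ?_, fun x hx' ↦ ?_, fun x hx' ↦ ?_⟩, ?_, trivial⟩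
    · obtain hx | hx := mem_Iio_or_eq hx' <;> obtain hy | hy := mem_Iio_or_eq hy'
      · rw [app_lt _ hx hx', app_lt _ hy hy', s.naturality]
      · rw [app_lt _ hx hx', app_eq _ hy hy', hl₃ _ _ _ _ (hx.trans_eq hy.symm)]
      · rw [app_eq _ hx hx', app_lt _ hy hy', hl₄ _ _ _ _ (hy.trans_eq hx.symm)]
      -- Two lifts in the same stratum were chosen independently; a nonidentity `k` passes through
      -- lower degree, where each agrees with the earlier lift.
      · obtain ⟨rfl, rfl⟩ | ⟨z, k₁, k₂, hz, rfl⟩ := hC k (hx.trans hy.symm)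
        · simp
        · rw [app_eq _ hx hx', app_eq _ hy hy', B.map_comp, X.map_comp, Category.assoc,
            hl₃ _ _ _ _ (hz.trans_eq (hx.trans hy.symm)), ← Category.assoc (l x hx),
            hl₄ _ _ _ _ hz, Category.assoc]
    · obtain hx | hx := mem_Iio_or_eq hx'
      · rw [app_lt _ hx hx', s.fac_left]
      · rw [app_eq _ hx hx', hl₁]
    · obtain hx | hx := mem_Iio_or_eq hx'
      · rw [app_lt _ hx hx', s.fac_right]
      · rw [app_eq _ hx hx', hl₂]
    · ext x hx
      exact app_lt x hx (Set.Iio_subset_Iic_self hx)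

end LiftingTheorem

/-! ### Partial factorizations and their gluing -/

section Factorization

variable {C : Type u} [Category.{u} C] (deg : C → Ordinal.{t}) {M : Type w} [Category.{v} M]
  {A B : C ⥤ M}

/-- A factorization of the component at `x` of a natural transformation. -/
structure FactObj (f : A ⟶ B) (x : C) where
  E : M
  i : A.obj x ⟶ E
  p : E ⟶ B.obj x
  fac : i ≫ p = f.app x

/-- The structure of a factorization of natural transformations on pointwise factorizations, over
the full subcategory of the objects of degree in `S`. -/
structure FactMaps {f : A ⟶ B} {S : Set Ordinal.{t}}
    (obj : ∀ x : C, deg x ∈ S → FactObj f x) where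
  map {x y : C} (hx : deg x ∈ S) (hy : deg y ∈ S) (k : x ⟶ y) : (obj x hx).E ⟶ (obj y hy).E
  map_id {x : C} (hx : deg x ∈ S) : map hx hx (𝟙 x) = 𝟙 _
  map_comp {x y z : C} (hx : deg x ∈ S) (hy : deg y ∈ S) (hz : deg z ∈ S) (k : x ⟶ y) (l : y ⟶ z) :
    map hx hy k ≫ map hy hz l = map hx hz (k ≫ l)
  i_map {x y : C} (hx : deg x ∈ S) (hy : deg y ∈ S) (k : x ⟶ y) :
    (obj x hx).i ≫ map hx hy k = A.map k ≫ (obj y hy).i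
  map_p {x y : C} (hx : deg x ∈ S) (hy : deg y ∈ S) (k : x ⟶ y) :
    map hx hy k ≫ (obj y hy).p = (obj x hx).p ≫ B.map k

attribute [ext] FactMaps

/-- A factorization of `f`, over the full subcategory of the objects of degree in `S`. -/
structure PartialFact (f : A ⟶ B) (S : Set Ordinal.{t}) where
  obj (x : C) (h : deg x ∈ S) : FactObj f x
  maps : FactMaps deg obj

variable {deg} {f : A ⟶ B}

lemma FactObj.i_eqToHom {x : C} {X Y : FactObj f x} (h : X = Y) (h' : X.E = Y.E) :
    X.i ≫ eqToHom h' = Y.i := by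
  subst h
  simp

lemma FactObj.eqToHom_p {x : C} {X Y : FactObj f x} (h : X = Y) (h' : X.E = Y.E) :
    eqToHom h' ≫ Y.p = X.p := by
  subst h
  simp

/-- Restriction of the structure maps. -/
def FactMaps.res {S T : Set Ordinal.{t}} (h : S ⊆ T) {obj : ∀ x : C, deg x ∈ T → FactObj f x}
    (s : FactMaps deg obj) : FactMaps deg (fun x (hx : deg x ∈ S) ↦ obj x (h hx)) where
  map hx hy k := s.map (h hx) (h hy) k
  map_id _ := s.map_id _
  map_comp _ _ _ k l := s.map_comp _ _ _ k l
  i_map _ _ k := s.i_map _ _ k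
  map_p _ _ k := s.map_p _ _ k

namespace PartialFact

/-- Restriction of partial factorizations. -/
def res {S T : Set Ordinal.{t}} (h : S ⊆ T) (s : PartialFact deg f T) : PartialFact deg f S where
  obj x hx := s.obj x (h hx)
  maps := s.maps.res h

lemma obj_eq_of_res {S T : Set Ordinal.{t}} {h : S ⊆ T} {s : PartialFact deg f T}
    {s' : PartialFact deg f S} (e : s.res h = s') {x : C} (hx : deg x ∈ S) (hx' : deg x ∈ T) :
    (s.obj x hx').E = (s'.obj x hx).E := by
  subst e
  rfl

lemma map_eq_of_res {S T : Set Ordinal.{t}} {h : S ⊆ T} {s : PartialFact deg f T}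
    {s' : PartialFact deg f S} (e : s.res h = s') {x y : C} (hx : deg x ∈ S) (hy : deg y ∈ S)
    (hx' : deg x ∈ T) (hy' : deg y ∈ T) (k : x ⟶ y) : s.maps.map hx' hy' k =
      eqToHom (obj_eq_of_res e hx hx') ≫ s'.maps.map hx hy k ≫
        eqToHom (obj_eq_of_res e hy hy').symm := by
  subst e
  exact ((Category.id_comp _).trans (Category.comp_id _)).symm

/-- Once the objects agree they can be substituted, leaving an equality of `FactMaps` over fixed
objects. Objects and maps are kept in separate structures for this reason. -/
lemma ext_of_eqToHom {S : Set Ordinal.{t}} {s s' : PartialFact deg f S}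
    (h : ∀ x hx, s.obj x hx = s'.obj x hx)
    (h' : ∀ (x y : C) (hx : deg x ∈ S) (hy : deg y ∈ S) (k : x ⟶ y), s.maps.map hx hy k =
      eqToHom (by rw [h]) ≫ s'.maps.map hx hy k ≫ eqToHom (by rw [h])) : s = s' := by
  obtain ⟨obj, m⟩ := s
  obtain ⟨obj', m'⟩ := s'
  obtain rfl : obj = obj' := by
    funext x hx
    exact h x hx
  congr 1
  ext x y hx hy k
  simpa using h' x y hx hy k

/-- The object at `x` is read at stage `deg x`, and the value on `k` at any stage containing both
degrees. Compatibility makes the latter independent of the stage up to `eqToHom`, so each identity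
can be checked at one common stage. -/
lemma existsUnique_glue {T : Set Ordinal.{t}} (hT : ∀ γ ∈ T, Set.Iic γ ⊆ T)
    (s : ∀ γ ∈ T, PartialFact deg f (Set.Iic γ))
    (hs : ∀ γ γ' (h : γ ∈ T) (h' : γ' ∈ T) (hle : γ ≤ γ'),
      (s γ' h').res (Set.Iic_subset_Iic.2 hle) = s γ h) :
    ∃! t : PartialFact deg f T, ∀ γ h, t.res (hT γ h) = s γ h := by
  let obj (x : C) (hx : deg x ∈ T) : FactObj f x := (s (deg x) hx).obj x Set.self_mem_Iic
  have hobj {x : C} (hx : deg x ∈ T) {γ} (hγ : γ ∈ T) (h : deg x ∈ Set.Iic γ) :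
      (s γ hγ).obj x h = obj x hx :=
    congrFun (congrFun (congrArg PartialFact.obj (hs _ _ hx hγ h)) x) Set.self_mem_Iic
  have hmax {γ γ'} (h : γ ∈ T) (h' : γ' ∈ T) :
      ∃ β ∈ T, γ ∈ Set.Iic β ∧ γ' ∈ Set.Iic β := by
    obtain h'' | h'' := mem_Iic_total γ γ'
    · exact ⟨γ', h', h'', Set.self_mem_Iic⟩
    · exact ⟨γ, h, Set.self_mem_Iic, h''⟩
  have hmap {x y : C} (hx : deg x ∈ T) (hy : deg y ∈ T) (k : x ⟶ y) :
      ∃ m : (obj x hx).E ⟶ (obj y hy).E, ∀ γ (hγ : γ ∈ T) (hx' : deg x ∈ Set.Iic γ)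
        (hy' : deg y ∈ Set.Iic γ), m = eqToHom (by rw [hobj hx hγ hx']) ≫
          (s γ hγ).maps.map hx' hy' k ≫ eqToHom (by rw [hobj hy hγ hy']) := by
    obtain ⟨β, hβ, hxβ, hyβ⟩ := hmax hx hy
    refine ⟨eqToHom (by rw [hobj hx hβ hxβ]) ≫
          (s β hβ).maps.map hxβ hyβ k ≫ eqToHom (by rw [hobj hy hβ hyβ]), fun γ hγ hx' hy' ↦ ?_⟩
    obtain h | h := le_total β γ
    · rw [map_eq_of_res (hs _ _ hβ hγ h) hxβ hyβ]
      simp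
    · rw [map_eq_of_res (hs _ _ hγ hβ h) hx' hy']
      simp
  choose map hmap using @hmap
  refine ⟨⟨obj, ⟨fun hx hy k ↦ map hx hy k, fun {x} hx ↦ ?_, fun {x y z} hx hy hz k l ↦ ?_,
    fun {x y} hx hy k ↦ ?_, fun {x y} hx hy k ↦ ?_⟩⟩, fun γ hγ ↦ ?_, fun t ht ↦ ?_⟩
  · rw [hmap hx hx (𝟙 x) _ hx Set.self_mem_Iic Set.self_mem_Iic, FactMaps.map_id]
    simp
  · obtain ⟨β, hβ, h₁, h₂⟩ := hmax hx hy
    obtain ⟨γ, hγ, h₃, h₄⟩ := hmax hβ hz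
    replace h₁ : deg x ∈ Set.Iic γ := Set.Iic_subset_Iic.2 h₃ h₁
    replace h₂ : deg y ∈ Set.Iic γ := Set.Iic_subset_Iic.2 h₃ h₂
    rw [hmap hx hy k γ hγ h₁ h₂, hmap hy hz l γ hγ h₂ h₄, hmap hx hz (k ≫ l) γ hγ h₁ h₄,
      ← (s γ hγ).maps.map_comp h₁ h₂ h₄]
    simp
  · obtain ⟨β, hβ, h₁, h₂⟩ := hmax hx hy
    rw [hmap hx hy k β hβ h₁ h₂, ← FactObj.i_eqToHom (hobj hy hβ h₂) (by rw [hobj hy hβ h₂]),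
      ← reassoc_of% (s β hβ).maps.i_map h₁ h₂, ← Category.assoc (obj x hx).i,
      FactObj.i_eqToHom (hobj hx hβ h₁).symm]
  · obtain ⟨β, hβ, h₁, h₂⟩ := hmax hx hy
    rw [hmap hx hy k β hβ h₁ h₂, Category.assoc, Category.assoc, FactObj.eqToHom_p (hobj hy hβ h₂),
      (s β hβ).maps.map_p h₁ h₂, ← Category.assoc, FactObj.eqToHom_p (hobj hx hβ h₁).symm]
  · refine ext_of_eqToHom (fun x hx ↦ (hobj (hT γ hγ hx) hγ hx).symm) (fun x y hx hy k ↦ ?_)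
    exact hmap _ _ k γ hγ hx hy
  · refine ext_of_eqToHom (fun x hx ↦ ?_) (fun x y hx hy k ↦ ?_)
    · exact congrFun (congrFun (congrArg PartialFact.obj (ht _ hx)) x) Set.self_mem_Iic
    · obtain ⟨β, hβ, h₁, h₂⟩ := hmax hx hy
      dsimp only
      rw [hmap hx hy k β hβ h₁ h₂]
      rw [map_eq_of_res (ht _ hβ) h₁ h₂]
      simp

end PartialFact

end Factorization

/-! ### Factorization at a new object -/

section Extension

variable {C : Type u} [Category.{u} C] {deg : C → Ordinal.{t}} {M : Type w} [Category.{v} M]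
  {A B : C ⥤ M} {f : A ⟶ B} {δ : Ordinal.{t}}

/-- The structure needed to add the object `x` to a factorization over the objects of degree
`< δ`. -/
structure StepData {obj : ∀ x : C, deg x ∈ Set.Iio δ → FactObj f x} (s : FactMaps deg obj) (x : C)
    (X : FactObj f x) where
  inn {y : C} (hy : deg y ∈ Set.Iio δ) (k : y ⟶ x) : (obj y hy).E ⟶ X.E
  out {y : C} (hy : deg y ∈ Set.Iio δ) (k : x ⟶ y) : X.E ⟶ (obj y hy).E
  map_inn {y y' : C} (hy : deg y ∈ Set.Iio δ) (hy' : deg y' ∈ Set.Iio δ) (m : y ⟶ y')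
    (k : y' ⟶ x) : s.map hy hy' m ≫ inn hy' k = inn hy (m ≫ k)
  out_map {y y' : C} (hy : deg y ∈ Set.Iio δ) (hy' : deg y' ∈ Set.Iio δ) (k : x ⟶ y)
    (m : y ⟶ y') : out hy k ≫ s.map hy hy' m = out hy' (k ≫ m)
  inn_out {y y' : C} (hy : deg y ∈ Set.Iio δ) (hy' : deg y' ∈ Set.Iio δ) (k : y ⟶ x)
    (k' : x ⟶ y') : inn hy k ≫ out hy' k' = s.map hy hy' (k ≫ k')
  i_inn {y : C} (hy : deg y ∈ Set.Iio δ) (k : y ⟶ x) : (obj y hy).i ≫ inn hy k = A.map k ≫ X.i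
  inn_p {y : C} (hy : deg y ∈ Set.Iio δ) (k : y ⟶ x) : inn hy k ≫ X.p = (obj y hy).p ≫ B.map k
  i_out {y : C} (hy : deg y ∈ Set.Iio δ) (k : x ⟶ y) : X.i ≫ out hy k = A.map k ≫ (obj y hy).i
  out_p {y : C} (hy : deg y ∈ Set.Iio δ) (k : x ⟶ y) : out hy k ≫ (obj y hy).p = X.p ≫ B.map k

/-- The left lifting property of the relative latching map in a step of the construction. -/
def StepData.LatchingLifts (R : MorphismProperty M)
    {obj : ∀ x : C, deg x ∈ Set.Iio δ → FactObj f x} {s : FactMaps deg obj} {x : C}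
    {X : FactObj f x} (d : StepData s x X) : Prop :=
  ∀ ⦃Y Z : M⦄ (p : Y ⟶ Z), R p → ∀ (a : A.obj x ⟶ Y) (b : X.E ⟶ Z)
    (φ : ∀ (y : C) (_ : y ⟶ x) (hy : deg y ∈ Set.Iio δ), (obj y hy).E ⟶ Y),
    a ≫ p = X.i ≫ b →
    (∀ y k h, (obj y h).i ≫ φ y k h = A.map k ≫ a) →
    (∀ y k h, φ y k h ≫ p = d.inn h k ≫ b) →
    (∀ y y' (m : y ⟶ y') k h h', s.map h h' m ≫ φ y' k h' = φ y (m ≫ k) h) →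
    ∃ l : X.E ⟶ Y, X.i ≫ l = a ∧ l ≫ p = b ∧ ∀ y k h, d.inn h k ≫ l = φ y k h

/-- The right lifting property of the relative matching map in a step of the construction. -/
def StepData.MatchingLifts (L : MorphismProperty M)
    {obj : ∀ x : C, deg x ∈ Set.Iio δ → FactObj f x} {s : FactMaps deg obj} {x : C}
    {X : FactObj f x} (d : StepData s x X) : Prop :=
  ∀ ⦃Y Z : M⦄ (i : Y ⟶ Z), L i → ∀ (a : Y ⟶ X.E) (b : Z ⟶ B.obj x)
    (φ : ∀ (y : C) (_ : x ⟶ y) (hy : deg y ∈ Set.Iio δ), Z ⟶ (obj y hy).E),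
    a ≫ X.p = i ≫ b →
    (∀ y k h, φ y k h ≫ (obj y h).p = b ≫ B.map k) →
    (∀ y k h, i ≫ φ y k h = a ≫ d.out h k) →
    (∀ y y' (m : y ⟶ y') k h h', φ y k h ≫ s.map h h' m = φ y' (k ≫ m) h') →
    ∃ l : Z ⟶ X.E, l ≫ X.p = b ∧ i ≫ l = a ∧ ∀ y k h, l ≫ d.out h k = φ y k h

/-- The functor underlying a factorization over the objects of degree `< δ`. -/
def FactMaps.functor {obj : ∀ x : C, deg x ∈ Set.Iio δ → FactObj f x} (s : FactMaps deg obj) :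
    Below deg δ ⥤ M where
  obj y := (obj y.obj y.property).E
  map k := s.map _ _ k.hom
  map_id _ := s.map_id _
  map_comp _ _ := (s.map_comp _ _ _ _ _).symm

/-- The first map of a factorization over the objects of degree `< δ`. -/
def FactMaps.natI {obj : ∀ x : C, deg x ∈ Set.Iio δ → FactObj f x} (s : FactMaps deg obj) :
    Below.ι deg δ ⋙ A ⟶ s.functor where
  app y := (obj y.obj y.property).i
  naturality _ _ k := (s.i_map _ _ k.hom).symm

/-- The second map of a factorization over the objects of degree `< δ`. -/
def FactMaps.natP {obj : ∀ x : C, deg x ∈ Set.Iio δ → FactObj f x} (s : FactMaps deg obj) :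
    s.functor ⟶ Below.ι deg δ ⋙ B where
  app y := (obj y.obj y.property).p
  naturality _ _ k := s.map_p _ _ k.hom

/-- One step of the construction of a factorization, for general weights: a map `g : XA ⟶ XB`
together with maps from the `U`-weighted colimit of `i : A' ⟶ E` and to the `W`-weighted limit of
`p : E ⟶ B'` is factored compatibly with these. -/
lemma exists_factorization_of_weights {D : Type u} [Category.{u} D]
    [HasLimitsOfSize.{u, u} M] [HasColimitsOfSize.{u, u} M]
    [HasPullbacks M] [HasPushouts M] (L R : MorphismProperty M) [L.IsWeakFactorizationSystem R]
    (U : Dᵒᵖ ⥤ Type u) (W : D ⥤ Type u) {A' E B' : D ⥤ M} (i : A' ⟶ E) (p : E ⟶ B')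
    {XA XB : M} (g : XA ⟶ XB)
    (αA : ∀ ⦃d⦄, U.obj (op d) → (A'.obj d ⟶ XA)) (αB : ∀ ⦃d⦄, W.obj d → (XB ⟶ B'.obj d))
    (ε : ∀ ⦃d d'⦄, U.obj (op d) → W.obj d' → (E.obj d ⟶ E.obj d'))
    (cA : ∀ ⦃d⦄, W.obj d → (XA ⟶ E.obj d)) (cB : ∀ ⦃d⦄, U.obj (op d) → (E.obj d ⟶ XB))
    (hαA : ∀ ⦃d d'⦄ (m : d ⟶ d') (u : U.obj (op d')), αA (U.map m.op u) = A'.map m ≫ αA u)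
    (hαB : ∀ ⦃d d'⦄ (m : d ⟶ d') (w : W.obj d), αB w ≫ B'.map m = αB (W.map m w))
    (hε₁ : ∀ ⦃d d' d''⦄ (m : d ⟶ d') (u : U.obj (op d')) (w : W.obj d''),
      ε (U.map m.op u) w = E.map m ≫ ε u w)
    (hε₂ : ∀ ⦃d d' d''⦄ (u : U.obj (op d)) (w : W.obj d') (m : d' ⟶ d''),
      ε u w ≫ E.map m = ε u (W.map m w))
    (hcA : ∀ ⦃d d'⦄ (m : d ⟶ d') (w : W.obj d), cA w ≫ E.map m = cA (W.map m w))
    (hcB : ∀ ⦃d d'⦄ (m : d ⟶ d') (u : U.obj (op d')), cB (U.map m.op u) = E.map m ≫ cB u)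
    (h₁ : ∀ ⦃d d'⦄ (u : U.obj (op d)) (w : W.obj d'), i.app d ≫ ε u w = αA u ≫ cA w)
    (h₂ : ∀ ⦃d⦄ (u : U.obj (op d)), i.app d ≫ cB u = αA u ≫ g)
    (h₃ : ∀ ⦃d d'⦄ (u : U.obj (op d)) (w : W.obj d'), ε u w ≫ p.app d' = cB u ≫ αB w)
    (h₄ : ∀ ⦃d⦄ (w : W.obj d), cA w ≫ p.app d = g ≫ αB w) :
    ∃ (N : M) (i' : XA ⟶ N) (p' : N ⟶ XB) (inn : ∀ ⦃d⦄, U.obj (op d) → (E.obj d ⟶ N))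
      (out : ∀ ⦃d⦄, W.obj d → (N ⟶ E.obj d)),
      i' ≫ p' = g ∧
      (∀ ⦃d d'⦄ (m : d ⟶ d') (u : U.obj (op d')), E.map m ≫ inn u = inn (U.map m.op u)) ∧
      (∀ ⦃d d'⦄ (m : d ⟶ d') (w : W.obj d), out w ≫ E.map m = out (W.map m w)) ∧
      (∀ ⦃d d'⦄ (u : U.obj (op d)) (w : W.obj d'), inn u ≫ out w = ε u w) ∧
      (∀ ⦃d⦄ (u : U.obj (op d)), i.app d ≫ inn u = αA u ≫ i') ∧
      (∀ ⦃d⦄ (u : U.obj (op d)), inn u ≫ p' = cB u) ∧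
      (∀ ⦃d⦄ (w : W.obj d), i' ≫ out w = cA w) ∧
      (∀ ⦃d⦄ (w : W.obj d), out w ≫ p.app d = p' ≫ αB w) ∧
      (∀ ⦃Y Z : M⦄ (q : Y ⟶ Z), R q → ∀ (a : XA ⟶ Y) (b : N ⟶ Z)
        (φ : ∀ ⦃d : D⦄, U.obj (op d) → (E.obj d ⟶ Y)), a ≫ q = i' ≫ b →
        (∀ ⦃d⦄ (u : U.obj (op d)), i.app d ≫ φ u = αA u ≫ a) →
        (∀ ⦃d⦄ (u : U.obj (op d)), φ u ≫ q = inn u ≫ b) →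
        (∀ ⦃d d'⦄ (m : d ⟶ d') (u : U.obj (op d')), E.map m ≫ φ u = φ (U.map m.op u)) →
        ∃ l : N ⟶ Y, i' ≫ l = a ∧ l ≫ q = b ∧ ∀ ⦃d⦄ (u : U.obj (op d)), inn u ≫ l = φ u) ∧
      (∀ ⦃Y Z : M⦄ (j : Y ⟶ Z), L j → ∀ (a : Y ⟶ N) (b : Z ⟶ XB)
        (φ : ∀ ⦃d : D⦄, W.obj d → (Z ⟶ E.obj d)), a ≫ p' = j ≫ b →
        (∀ ⦃d⦄ (w : W.obj d), φ w ≫ p.app d = b ≫ αB w) →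
        (∀ ⦃d⦄ (w : W.obj d), j ≫ φ w = a ≫ out w) →
        (∀ ⦃d d'⦄ (m : d ⟶ d') (w : W.obj d), φ w ≫ E.map m = φ (W.map m w)) →
        ∃ l : Z ⟶ N, l ≫ p' = b ∧ j ≫ l = a ∧ ∀ ⦃d⦄ (w : W.obj d), l ≫ out w = φ w) := by
  let αA' : weightedColim U A' ⟶ XA := weightedColim.desc U A' αA hαA
  have hαA' {d} (u : U.obj (op d)) : weightedColim.ι U A' u ≫ αA' = αA u :=
    weightedColim.ι_desc _ _ _ _ _
  let αB' : XB ⟶ W.weightedLimObjObj B' := (W.isLimitWeightedLimCone B').lift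
    (fun _ w ↦ αB w) (fun _ _ w m ↦ hαB m w)
  have hαB' {d} (w : W.obj d) : αB' ≫ W.weightedLimObjObjπ B' w = αB w :=
    W.isLimitWeightedLimCone_fac _ _ _ w
  let ε' {d} (u : U.obj (op d)) : E.obj d ⟶ W.weightedLimObjObj E :=
    (W.isLimitWeightedLimCone E).lift (fun _ w ↦ ε u w) (fun _ _ w m ↦ hε₂ u w m)
  have hε' {d d'} (u : U.obj (op d)) (w : W.obj d') :
      ε' u ≫ W.weightedLimObjObjπ E w = ε u w :=
    W.isLimitWeightedLimCone_fac _ _ _ w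
  let ε'' : weightedColim U E ⟶ W.weightedLimObjObj E :=
    weightedColim.desc U E (fun _ u ↦ ε' u) (fun _ _ m u ↦ by
      apply Functor.weightedLimObjObj.hom_ext
      intro d w
      rw [Category.assoc, hε', hε', hε₁])
  have hε'' {d} (u : U.obj (op d)) : weightedColim.ι U E u ≫ ε'' = ε' u :=
    weightedColim.ι_desc _ _ _ _ _
  let cA' : XA ⟶ W.weightedLimObjObj E := (W.isLimitWeightedLimCone E).lift
    (fun _ w ↦ cA w) (fun _ _ w m ↦ hcA m w)
  have hcA' {d} (w : W.obj d) : cA' ≫ W.weightedLimObjObjπ E w = cA w :=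
    W.isLimitWeightedLimCone_fac _ _ _ w
  let cB' : weightedColim U E ⟶ XB := weightedColim.desc U E cB hcB
  have hcB' {d} (u : U.obj (op d)) : weightedColim.ι U E u ≫ cB' = cB u :=
    weightedColim.ι_desc _ _ _ _ _
  have e₁ : weightedColim.map U i ≫ ε'' = αA' ≫ cA' := by
    apply weightedColim.hom_ext
    intro d u
    apply Functor.weightedLimObjObj.hom_ext
    intro d' w
    rw [← Category.assoc (weightedColim.ι U A' u), weightedColim.ι_map]
    simp only [Category.assoc]
    rw [reassoc_of% hε'', hε', reassoc_of% hαA', hcA', h₁]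
  have e₂ : weightedColim.map U i ≫ cB' = αA' ≫ g := by
    apply weightedColim.hom_ext
    intro d u
    rw [← Category.assoc, weightedColim.ι_map, Category.assoc, hcB', reassoc_of% hαA', h₂]
  let Q := pushout (weightedColim.map U i) αA'
  have e₃ : (pushout.desc ε'' cA' e₁ : Q ⟶ _) ≫ W.weightedLimObjMap p =
      pushout.desc cB' g e₂ ≫ αB' := by
    apply pushout.hom_ext
    · rw [← Category.assoc, pushout.inl_desc, ← Category.assoc, pushout.inl_desc]
      apply weightedColim.hom_ext
      intro d u
      apply Functor.weightedLimObjObj.hom_ext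
      intro d' w
      rw [reassoc_of% hε'', Category.assoc, Functor.weightedLimObjMap_π, reassoc_of% hε',
        reassoc_of% hcB', Category.assoc, hαB', h₃]
    · rw [← Category.assoc, pushout.inr_desc, ← Category.assoc, pushout.inr_desc]
      apply Functor.weightedLimObjObj.hom_ext
      intro d w
      rw [Category.assoc, Functor.weightedLimObjMap_π, reassoc_of% hcA', Category.assoc, hαB', h₄]
  -- The canonical map from the relative latching object to the relative matching object; `ε`
  -- provides the component from the weighted colimit to the weighted limit.
  let c : Q ⟶ pullback (W.weightedLimObjMap p) αB' :=
    pullback.lift (pushout.desc ε'' cA' e₁) (pushout.desc cB' g e₂) e₃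
  obtain ⟨N, j, q, fac, hj, hq⟩ := MorphismProperty.factorizationData L R c
  rw [← MorphismProperty.llp_eq_of_wfs L R, llp_pushout_weightedColim_iff] at hj
  rw [← MorphismProperty.rlp_eq_of_wfs L R, rlp_pullback_weightedLim_iff] at hq
  have f₁ : j ≫ q ≫ pullback.fst _ _ = pushout.desc ε'' cA' e₁ := by
    rw [reassoc_of% fac, pullback.lift_fst]
  have f₂ : j ≫ q ≫ pullback.snd _ _ = pushout.desc cB' g e₂ := by
    rw [reassoc_of% fac, pullback.lift_snd]
  refine ⟨N, pushout.inr _ _ ≫ j, q ≫ pullback.snd _ _,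
    fun d u ↦ weightedColim.ι U E u ≫ pushout.inl _ _ ≫ j,
    fun d w ↦ q ≫ pullback.fst _ _ ≫ W.weightedLimObjObjπ E w, ?_, ?_, ?_, ?_, ?_, ?_, ?_, ?_,
    ?_, ?_⟩
  · rw [Category.assoc, f₂, pushout.inr_desc]
  · intro d d' m u
    rw [← Category.assoc, weightedColim.ι_w]
  · intro d d' m w
    simp
  · intro d d' u w
    simp only [Category.assoc]
    rw [reassoc_of% f₁, pushout.inl_desc_assoc, reassoc_of% hε'', hε']
  · intro d u
    rw [← Category.assoc, ← weightedColim.ι_map, Category.assoc, pushout.condition_assoc,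
      reassoc_of% hαA']
  · intro d u
    simp only [Category.assoc]
    rw [f₂, pushout.inl_desc, hcB']
  · intro d w
    simp only [Category.assoc]
    rw [reassoc_of% f₁, pushout.inr_desc_assoc, hcA']
  · intro d w
    simp only [Category.assoc]
    rw [← Functor.weightedLimObjMap_π, pullback.condition_assoc, hαB']
  · intro Y Z q' hq' a b φ k₁ k₂ k₃ k₄
    exact hj q' hq' a b φ k₁ (fun d u ↦ by rw [hαA', k₂]) k₃ k₄
  · intro Y Z j' hj' a b φ k₁ k₂ k₃ k₄
    obtain ⟨l, hl₁, hl₂, hl₃⟩ := hq j' hj' a b φ k₁ (fun d w ↦ by rw [hαB', k₂]) k₃ k₄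
    exact ⟨l, hl₁, hl₂, hl₃⟩

/-- The map from the latching to the matching object already exists: its component at `y ⟶ x ⟶ z` is
the value of `s` on the composite. Nothing is required of the degree of `x`, as the weights are
taken over degree `< δ`. -/
lemma FactMaps.exists_stepData [HasLimitsOfSize.{u, u} M] [HasColimitsOfSize.{u, u} M]
    [HasPullbacks M] [HasPushouts M] (L R : MorphismProperty M)
    [L.IsWeakFactorizationSystem R]
    {obj : ∀ x : C, deg x ∈ Set.Iio δ → FactObj f x} (s : FactMaps deg obj) (x : C) :
    ∃ (X : FactObj f x) (d : StepData s x X), d.LatchingLifts R ∧ d.MatchingLifts L := by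
  have mem (y : Below deg δ) : deg y.obj ∈ Set.Iio δ := y.property
  obtain ⟨N, i', p', inn, out, h₁, h₂, h₃, h₄, h₅, h₆, h₇, h₈, h₉, h₁₀⟩ :=
    exists_factorization_of_weights L R (homTo deg x δ) (homFrom deg x δ) s.natI s.natP
      (f.app x) (fun y k ↦ A.map k) (fun y k ↦ B.map k)
      (fun y z k l ↦ s.map (mem y) (mem z) (k ≫ l))
      (fun y k ↦ A.map k ≫ (obj y.obj (mem y)).i) (fun y k ↦ (obj y.obj (mem y)).p ≫ B.map k)
      (fun y y' m k ↦ A.map_comp _ _) (fun y y' m k ↦ (B.map_comp _ _).symm)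
      (fun y y' z m k l ↦ (congrArg _ (Category.assoc _ _ _)).trans (s.map_comp _ _ _ _ _).symm)
      (fun y z z' k l m ↦ (s.map_comp _ _ _ _ _).trans (congrArg _ (Category.assoc _ _ _)))
      (fun y y' m k ↦ by
        refine (Category.assoc _ _ _).trans ((_ ≫= s.i_map (mem y) (mem y') m.hom).trans ?_)
        rw [← Category.assoc, ← A.map_comp]
        rfl)
      (fun y y' m k ↦ by
        refine Eq.trans ?_ ((s.map_p (mem y) (mem y') m.hom =≫ _).symm.trans
          (Category.assoc _ _ _))
        rw [Category.assoc, ← B.map_comp]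
        rfl)
      (fun y z k l ↦ by
        refine (s.i_map (mem y) (mem z) (k ≫ l)).trans ?_
        rw [A.map_comp, Category.assoc]
        rfl)
      (fun y k ↦ by
        refine (Category.assoc _ _ _).symm.trans (((obj y.obj (mem y)).fac =≫ _).trans ?_)
        exact (f.naturality k).symm)
      (fun y z k l ↦ by
        refine (s.map_p (mem y) (mem z) (k ≫ l)).trans ?_
        rw [B.map_comp]
        exact (Category.assoc _ _ _).symm)
      (fun y k ↦ by
        refine (Category.assoc _ _ _).trans ((_ ≫= (obj y.obj (mem y)).fac).trans ?_)
        exact f.naturality k)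
  refine ⟨⟨N, i', p', h₁⟩,
    { inn := fun {y} hy k ↦ inn (d := ⟨y, hy⟩) k
      out := fun {y} hy k ↦ out (d := ⟨y, hy⟩) k
      map_inn := fun {y y'} hy hy' m k ↦
        h₂ (d := ⟨y, hy⟩) (d' := ⟨y', hy'⟩) (ObjectProperty.homMk m) k
      out_map := fun {y y'} hy hy' k m ↦
        h₃ (d := ⟨y, hy⟩) (d' := ⟨y', hy'⟩) (ObjectProperty.homMk m) k
      inn_out := fun {y y'} hy hy' k l ↦ h₄ (d := ⟨y, hy⟩) (d' := ⟨y', hy'⟩) k l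
      i_inn := fun {y} hy k ↦ h₅ (d := ⟨y, hy⟩) k
      inn_p := fun {y} hy k ↦ h₆ (d := ⟨y, hy⟩) k
      i_out := fun {y} hy k ↦ h₇ (d := ⟨y, hy⟩) k
      out_p := fun {y} hy k ↦ h₈ (d := ⟨y, hy⟩) k }, ?_, ?_⟩
  · intro Y Z q hq a b φ k₁ k₂ k₃ k₄
    obtain ⟨l, hl₁, hl₂, hl₃⟩ := h₉ q hq a b (fun y k ↦ φ y.obj k y.property) k₁
      (fun y k ↦ k₂ _ k y.property) (fun y k ↦ k₃ _ k y.property)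
      (fun y y' m k ↦ k₄ _ _ m.hom k y.property y'.property)
    exact ⟨l, hl₁, hl₂, fun y k hy ↦ hl₃ (d := ⟨y, hy⟩) k⟩
  · intro Y Z q hq a b φ k₁ k₂ k₃ k₄
    obtain ⟨l, hl₁, hl₂, hl₃⟩ := h₁₀ q hq a b (fun y k ↦ φ y.obj k y.property) k₁
      (fun y k ↦ k₂ _ k y.property) (fun y k ↦ k₃ _ k y.property)
      (fun y y' m k ↦ k₄ _ _ m.hom k y.property y'.property)
    exact ⟨l, hl₁, hl₂, fun y k hy ↦ hl₃ (d := ⟨y, hy⟩) k⟩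

end Extension

/-! ### Extension across a stratum and the Reedy factorization -/

section Factorization

variable {C : Type u} [Category.{u} C] {deg : C → Ordinal.{t}} {M : Type w} [Category.{v} M]
  {A B : C ⥤ M} {f : A ⟶ B} {δ : Ordinal.{t}}

/-- The map between two objects of degree `δ` determined by the maps from and to the objects of
lower degree. -/
lemma StepData.exists_map (hC : EqOrFactors deg)
    (hid : ∀ ⦃x z : C⦄, deg z < deg x → ∀ (k₁ : x ⟶ z) (k₂ : z ⟶ x), k₁ ≫ k₂ ≠ 𝟙 x)
    (hconn : ∀ ⦃x y : C⦄, deg x = deg y → LowFactorizationsConnected deg (deg x) x y)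
    {obj : ∀ x : C, deg x ∈ Set.Iio δ → FactObj f x} {s : FactMaps deg obj}
    {O : ∀ x : C, deg x = δ → FactObj f x} (d : ∀ (x : C) (hx : deg x = δ), StepData s x (O x hx))
    {x y : C} (hx : deg x = δ) (hy : deg y = δ) (k : x ⟶ y) :
    ∃ m : (O x hx).E ⟶ (O y hy).E,
      (∀ e : x = y, k = eqToHom e → m = eqToHom (by subst e; rfl)) ∧
      ∀ (z : C) (hz : deg z ∈ Set.Iio δ) (k₁ : x ⟶ z) (k₂ : z ⟶ y), k₁ ≫ k₂ = k →
        m = (d x hx).out hz k₁ ≫ (d y hy).inn hz k₂ := by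
  subst hx
  obtain ⟨rfl, rfl⟩ | ⟨z, k₁, k₂, hz, rfl⟩ := hC k hy.symm
  · refine ⟨𝟙 _, fun _ _ ↦ by simp, fun z hz k₁ k₂ e ↦ ?_⟩
    exact (hid hz k₁ k₂ (by simpa using e)).elim
  · refine ⟨(d x rfl).out hz k₁ ≫ (d y hy).inn hz k₂, fun e e' ↦ ?_, fun z' hz' k₁' k₂' e ↦ ?_⟩
    · subst e
      exact (hid hz k₁ k₂ (by simpa using e')).elim
    -- Going out of `x` and into `y` through the middle object is invariant under slides, by
    -- `out_map` and `map_inn`; `hconn` then gives independence of the factorization.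
    · refine LowFactorization.eq_of_eqvGen
        (fun t : LowFactorization deg (deg x) x y ↦
          (d x rfl).out t.lt t.fst ≫ (d y hy).inn t.lt t.snd) ?_
        (hconn hy.symm ⟨z, hz, k₁, k₂⟩ ⟨z', hz', k₁', k₂'⟩ e.symm)
      rintro ⟨z, hz, k₁, k₂⟩ ⟨z', hz', k₁', k₂'⟩ ⟨m, e₁, e₂⟩
      dsimp at m e₁ e₂
      subst e₁ e₂
      exact (_ ≫= ((d y hy).map_inn hz hz' m k₂').symm).trans
        ((Category.assoc _ _ _).symm.trans ((d x rfl).out_map hz hz' k₁ m =≫ _))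

/-- Functoriality within the stratum reduces to lower degree: a nonidentity map acts as an `out`
followed by an `inn`, and an `inn` followed by an `out` is a value of `s`. -/
lemma FactMaps.exists_extension (hC : EqOrFactors deg)
    (hid : ∀ ⦃x z : C⦄, deg z < deg x → ∀ (k₁ : x ⟶ z) (k₂ : z ⟶ x), k₁ ≫ k₂ ≠ 𝟙 x)
    (hconn : ∀ ⦃x y : C⦄, deg x = deg y → LowFactorizationsConnected deg (deg x) x y)
    {O : ∀ x : C, deg x ∈ Set.Iic δ → FactObj f x}
    (s : FactMaps deg (fun x hx ↦ O x (Set.Iio_subset_Iic_self hx)))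
    (d : ∀ (x : C) (hx : deg x = δ), StepData s x (O x (Set.mem_Iic.2 hx.le))) :
    ∃ t : FactMaps deg O, t.res Set.Iio_subset_Iic_self = s ∧
      (∀ (x y : C) (hx : deg x = δ) (hx' : deg x ∈ Set.Iic δ) (hy : deg y ∈ Set.Iio δ) (k : y ⟶ x),
        t.map (Set.Iio_subset_Iic_self hy) hx' k = (d x hx).inn hy k) ∧
      (∀ (x y : C) (hx : deg x = δ) (hx' : deg x ∈ Set.Iic δ) (hy : deg y ∈ Set.Iio δ) (k : x ⟶ y),
        t.map hx' (Set.Iio_subset_Iic_self hy) k = (d x hx).out hy k) := by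
  have hrr {x y : C} (hx : deg x = δ) (hy : deg y = δ) (k : x ⟶ y) :=
    StepData.exists_map hC hid hconn (O := fun x hx ↦ O x (Set.mem_Iic.2 hx.le)) d hx hy k
  choose rr rr_eqToHom rr_factors using @hrr
  have rr_id {x : C} (hx : deg x = δ) : rr hx hx (𝟙 x) = 𝟙 _ := rr_eqToHom hx hx _ rfl rfl
  classical
  let map {x y : C} (hx : deg x ∈ Set.Iic δ) (hy : deg y ∈ Set.Iic δ) (k : x ⟶ y) :
      (O x hx).E ⟶ (O y hy).E :=
    if hx' : deg x ∈ Set.Iio δ then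
      if hy' : deg y ∈ Set.Iio δ then s.map hx' hy' k
      else (d y ((mem_Iio_or_eq hy).resolve_left hy')).inn hx' k
    else
      if hy' : deg y ∈ Set.Iio δ then (d x ((mem_Iio_or_eq hx).resolve_left hx')).out hy' k
      else rr ((mem_Iio_or_eq hx).resolve_left hx') ((mem_Iio_or_eq hy).resolve_left hy') k
  have hne {x : C} (hx : deg x = δ) : deg x ∉ Set.Iio δ := hx.not_lt
  have map_ll {x y : C} (hx hy k) (hx' : deg x ∈ Set.Iio δ) (hy' : deg y ∈ Set.Iio δ) :
      map hx hy k = s.map hx' hy' k := by simp only [map, dif_pos hx', dif_pos hy']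
  have map_lr {x y : C} (hx hy k) (hx' : deg x ∈ Set.Iio δ) (hy' : deg y = δ) :
      map hx hy k = (d y hy').inn hx' k := by simp only [map, dif_pos hx', dif_neg (hne hy')]
  have map_rl {x y : C} (hx hy k) (hx' : deg x = δ) (hy' : deg y ∈ Set.Iio δ) :
      map hx hy k = (d x hx').out hy' k := by simp only [map, dif_neg (hne hx'), dif_pos hy']
  have map_rr {x y : C} (hx hy k) (hx' : deg x = δ) (hy' : deg y = δ) :
      map hx hy k = rr hx' hy' k := by simp only [map, dif_neg (hne hx'), dif_neg (hne hy')]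
  have mem {x z : C} (hx : deg x = δ) (hz : deg z < deg x) : deg z ∈ Set.Iio δ := hz.trans_eq hx
  have inn_rr {x y z : C} (hx : deg x ∈ Set.Iio δ) (hy : deg y = δ) (hz : deg z = δ) (k : x ⟶ y)
      (l : y ⟶ z) : (d y hy).inn hx k ≫ rr hy hz l = (d z hz).inn hx (k ≫ l) := by
    obtain ⟨rfl, rfl⟩ | ⟨w, l₁, l₂, hw, rfl⟩ := hC l (hy.trans hz.symm)
    · simp [rr_id]
    · rw [rr_factors hy hz _ w (mem hy hw) l₁ l₂ rfl, ← Category.assoc,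
        (d y hy).inn_out, (d z hz).map_inn]
      simp
  have rr_out {x y z : C} (hx : deg x = δ) (hy : deg y = δ) (hz : deg z ∈ Set.Iio δ) (k : x ⟶ y)
      (l : y ⟶ z) : rr hx hy k ≫ (d y hy).out hz l = (d x hx).out hz (k ≫ l) := by
    obtain ⟨rfl, rfl⟩ | ⟨w, k₁, k₂, hw, rfl⟩ := hC k (hx.trans hy.symm)
    · simp [rr_id]
    · rw [rr_factors hx hy _ w (mem hx hw) k₁ k₂ rfl, Category.assoc,
        (d y hy).inn_out, (d x hx).out_map]
      simp
  have rr_rr {x y z : C} (hx : deg x = δ) (hy : deg y = δ) (hz : deg z = δ) (k : x ⟶ y)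
      (l : y ⟶ z) : rr hx hy k ≫ rr hy hz l = rr hx hz (k ≫ l) := by
    obtain ⟨rfl, rfl⟩ | ⟨w, k₁, k₂, hw, rfl⟩ := hC k (hx.trans hy.symm)
    · simp [rr_id]
    · rw [rr_factors hx hy _ w (mem hx hw) k₁ k₂ rfl, Category.assoc, inn_rr,
        rr_factors hx hz _ w (mem hx hw) k₁ (k₂ ≫ l) (by simp)]
  refine ⟨⟨fun hx hy k ↦ map hx hy k, fun {x} hx ↦ ?_, fun {x y z} hx hy hz k l ↦ ?_,
    fun {x y} hx hy k ↦ ?_, fun {x y} hx hy k ↦ ?_⟩, ?_, ?_, ?_⟩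
  · obtain hx' | hx' := mem_Iio_or_eq hx
    · rw [map_ll _ _ _ hx' hx', s.map_id]
    · rw [map_rr _ _ _ hx' hx', rr_id]
  · obtain hx' | hx' := mem_Iio_or_eq hx <;> obtain hy' | hy' := mem_Iio_or_eq hy <;>
      obtain hz' | hz' := mem_Iio_or_eq hz
    · rw [map_ll _ _ _ hx' hy', map_ll _ _ _ hy' hz', map_ll _ _ _ hx' hz', s.map_comp]
    · rw [map_ll _ _ _ hx' hy', map_lr _ _ _ hy' hz', map_lr _ _ _ hx' hz', (d z hz').map_inn]
    · rw [map_lr _ _ _ hx' hy', map_rl _ _ _ hy' hz', map_ll _ _ _ hx' hz', (d y hy').inn_out]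
    · rw [map_lr _ _ _ hx' hy', map_rr _ _ _ hy' hz', map_lr _ _ _ hx' hz', inn_rr]
    · rw [map_rl _ _ _ hx' hy', map_ll _ _ _ hy' hz', map_rl _ _ _ hx' hz', (d x hx').out_map]
    · rw [map_rl _ _ _ hx' hy', map_lr _ _ _ hy' hz', map_rr _ _ _ hx' hz',
        rr_factors hx' hz' _ y hy' k l rfl]
    · rw [map_rr _ _ _ hx' hy', map_rl _ _ _ hy' hz', map_rl _ _ _ hx' hz', rr_out]
    · rw [map_rr _ _ _ hx' hy', map_rr _ _ _ hy' hz', map_rr _ _ _ hx' hz', rr_rr]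
  · obtain hx' | hx' := mem_Iio_or_eq hx <;> obtain hy' | hy' := mem_Iio_or_eq hy
    · rw [map_ll _ _ _ hx' hy', s.i_map]
    · rw [map_lr _ _ _ hx' hy', (d y hy').i_inn hx']
    · rw [map_rl _ _ _ hx' hy', (d x hx').i_out hy']
    · rw [map_rr _ _ _ hx' hy']
      obtain ⟨rfl, rfl⟩ | ⟨w, k₁, k₂, hw, rfl⟩ := hC k (hx'.trans hy'.symm)
      · simp [rr_id]
      · rw [rr_factors hx' hy' _ w (mem hx' hw) k₁ k₂ rfl, ← Category.assoc, (d x hx').i_out,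
          Category.assoc, (d y hy').i_inn, A.map_comp, Category.assoc]
  · obtain hx' | hx' := mem_Iio_or_eq hx <;> obtain hy' | hy' := mem_Iio_or_eq hy
    · rw [map_ll _ _ _ hx' hy', s.map_p]
    · rw [map_lr _ _ _ hx' hy', (d y hy').inn_p hx']
    · rw [map_rl _ _ _ hx' hy', (d x hx').out_p hy']
    · rw [map_rr _ _ _ hx' hy']
      obtain ⟨rfl, rfl⟩ | ⟨w, k₁, k₂, hw, rfl⟩ := hC k (hx'.trans hy'.symm)
      · simp [rr_id]
      · rw [rr_factors hx' hy' _ w (mem hx' hw) k₁ k₂ rfl, Category.assoc, (d y hy').inn_p,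
          ← Category.assoc, (d x hx').out_p, B.map_comp, Category.assoc]
  · ext x y hx hy k
    exact map_ll _ _ _ hx hy
  · intro x y hx hx' hy k
    exact map_lr _ _ _ hy hx
  · intro x y hx hx' hy k
    exact map_rl _ _ _ hx hy

lemma PartialFact.exists_extension [HasLimitsOfSize.{u, u} M] [HasColimitsOfSize.{u, u} M]
    [HasPullbacks M] [HasPushouts M] (hC : EqOrFactors deg)
    (hid : ∀ ⦃x z : C⦄, deg z < deg x → ∀ (k₁ : x ⟶ z) (k₂ : z ⟶ x), k₁ ≫ k₂ ≠ 𝟙 x)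
    (hconn : ∀ ⦃x y : C⦄, deg x = deg y → LowFactorizationsConnected deg (deg x) x y)
    (L R : MorphismProperty M) [L.IsWeakFactorizationSystem R]
    (s : PartialFact deg f (Set.Iio δ)) :
    ∃ t : PartialFact deg f (Set.Iic δ), t.res Set.Iio_subset_Iic_self = s ∧
      ∀ (x : C) (_ : deg x = δ) (hx' : deg x ∈ Set.Iic δ),
        ∃ d : StepData (t.maps.res Set.Iio_subset_Iic_self) x (t.obj x hx'),
          d.LatchingLifts R ∧ d.MatchingLifts L ∧
          (∀ (y : C) (hy : deg y ∈ Set.Iio δ) (k : y ⟶ x),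
            t.maps.map (Set.Iio_subset_Iic_self hy) hx' k = d.inn hy k) ∧
          (∀ (y : C) (hy : deg y ∈ Set.Iio δ) (k : x ⟶ y),
            t.maps.map hx' (Set.Iio_subset_Iic_self hy) k = d.out hy k) := by
  classical
  obtain ⟨obj, s⟩ := s
  choose X d hd hd' using s.exists_stepData L R
  -- With `O` abstract, `obj` can be replaced by a literal restriction of `O`, so that `s` needs no
  -- transport.
  obtain ⟨O, hO, hO'⟩ : ∃ O : ∀ x : C, deg x ∈ Set.Iic δ → FactObj f x,
      obj = (fun x hx ↦ O x (Set.Iio_subset_Iic_self hx)) ∧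
      ∀ (x : C) (hx : deg x = δ) (hx' : deg x ∈ Set.Iic δ), O x hx' = X x := by
    refine ⟨fun x _ ↦ if h : deg x ∈ Set.Iio δ then obj x h else X x, ?_, fun x hx hx' ↦ ?_⟩
    · funext x hx
      exact (dif_pos hx).symm
    · exact dif_neg hx.not_lt
  subst hO
  have hd'' (x : C) (hx : deg x = δ) : ∃ d : StepData s x (O x (Set.mem_Iic.2 hx.le)),
      d.LatchingLifts R ∧ d.MatchingLifts L := by
    rw [hO' x hx (Set.mem_Iic.2 hx.le)]
    exact ⟨d x, hd x, hd' x⟩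
  choose d hd hd' using hd''
  obtain ⟨t, rfl, ht₁, ht₂⟩ := s.exists_extension hC hid hconn d
  exact ⟨⟨O, t⟩, rfl, fun x hx hx' ↦ ⟨d x hx, hd x hx, hd' x hx,
    fun y hy k ↦ ht₁ x y hx hx' hy k, fun y hy k ↦ ht₂ x y hx hx' hy k⟩⟩

/-- The factorization for the Reedy weak factorization system. -/
theorem exists_reedy_factorization [HasLimitsOfSize.{u, u} M] [HasColimitsOfSize.{u, u} M]
    [HasPullbacks M] [HasPushouts M] (hC : EqOrFactors deg)
    (hid : ∀ ⦃x z : C⦄, deg z < deg x → ∀ (k₁ : x ⟶ z) (k₂ : z ⟶ x), k₁ ≫ k₂ ≠ 𝟙 x)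
    (hconn : ∀ ⦃x y : C⦄, deg x = deg y → LowFactorizationsConnected deg (deg x) x y)
    (L R : MorphismProperty M) [L.IsWeakFactorizationSystem R] (f : A ⟶ B) :
    ∃ (E : C ⥤ M) (i : A ⟶ E) (p : E ⟶ B), i ≫ p = f ∧ (∀ x, LatchingLifts deg R i x) ∧
      ∀ x, MatchingLifts deg L p x := by
  obtain ⟨t, ht⟩ := exists_section_of_extensions (F := PartialFact deg f) PartialFact.res
    (fun _ ↦ rfl) (fun _ _ _ ↦ rfl) (fun T hT s hs ↦ PartialFact.existsUnique_glue hT s hs) _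
    (fun δ s ↦ s.exists_extension hC hid hconn L R)
  have mem (x : C) : deg x ∈ Set.univ := trivial
  refine ⟨⟨fun x ↦ (t.obj x (mem x)).E, fun k ↦ t.maps.map _ _ k, fun x ↦ t.maps.map_id _,
    fun k l ↦ (t.maps.map_comp _ _ _ k l).symm⟩, ⟨fun x ↦ (t.obj x (mem x)).i,
    fun x y k ↦ (t.maps.i_map _ _ k).symm⟩, ⟨fun x ↦ (t.obj x (mem x)).p,
    fun x y k ↦ t.maps.map_p _ _ k⟩, ?_, fun x ↦ ?_, fun x ↦ ?_⟩
  · ext x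
    exact (t.obj x (mem x)).fac
  -- At stage `deg x`, the bound `Iio (deg x)` of the step is exactly the range of the latching
  -- object at `x`.
  · obtain ⟨d, hd, -, hin, -⟩ := ht (deg x) x rfl Set.self_mem_Iic
    intro Y Z p hp a b φ h₁ h₂ h₃ h₄
    obtain ⟨l, hl₁, hl₂, hl₃⟩ := hd p hp a b φ h₁ h₂
      (fun y k h ↦ (h₃ y k h).trans (hin y h k =≫ b)) h₄
    exact ⟨l, hl₁, hl₂, fun y k h ↦ (hin y h k =≫ l).trans (hl₃ y k h)⟩
  · obtain ⟨d, -, hd, -, hout⟩ := ht (deg x) x rfl Set.self_mem_Iic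
    intro Y Z i hi a b φ h₁ h₂ h₃ h₄
    obtain ⟨l, hl₁, hl₂, hl₃⟩ := hd i hi a b φ h₁ h₂
      (fun y k h ↦ (h₃ y k h).trans (a ≫= hout y h k)) h₄
    exact ⟨l, hl₁, hl₂, fun y k h ↦ (l ≫= hout y h k).trans (hl₃ y k h)⟩

end Factorization

/-! ### Latching and matching maps via constant diagrams -/

section Latching

variable {C : Type u} [Category.{u} C]

/-- The maps to `x` from the objects of lower degree. -/
structure LowOver (deg : C → Ordinal.{t}) (x : C) : Type u where
  obj : C
  lt : deg obj < deg x
  hom : obj ⟶ x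

/-- The maps from `x` to the objects of lower degree. -/
structure LowUnder (deg : C → Ordinal.{t}) (x : C) : Type u where
  obj : C
  lt : deg obj < deg x
  hom : x ⟶ obj

variable {deg : C → Ordinal.{t}} {x : C}

instance : Category.{u} (LowOver deg x) where
  Hom y z := { k : y.obj ⟶ z.obj // k ≫ z.hom = y.hom }
  id y := ⟨𝟙 _, by simp⟩
  comp k l := ⟨k.1 ≫ l.1, by rw [Category.assoc, l.2, k.2]⟩

instance : Category.{u} (LowUnder deg x) where
  Hom y z := { k : y.obj ⟶ z.obj // y.hom ≫ k = z.hom }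
  id y := ⟨𝟙 _, by simp⟩
  comp k l := ⟨k.1 ≫ l.1, by rw [← Category.assoc, k.2, l.2]⟩

/-- The forgetful functor. -/
def LowOver.forget (deg : C → Ordinal.{t}) (x : C) : LowOver deg x ⥤ C where
  obj y := y.obj
  map k := k.1

/-- The forgetful functor. -/
def LowUnder.forget (deg : C → Ordinal.{t}) (x : C) : LowUnder deg x ⥤ C where
  obj y := y.obj
  map k := k.1

/-- An object through which a map over `x` factors acquires its own map to `x` from the second half
of the factorization. -/
lemma LowOver.eqOrFactors (hC : EqOrFactors deg) :
    EqOrFactors (fun y : LowOver deg x ↦ deg y.obj) := by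
  rintro ⟨y, hy, g⟩ ⟨z, hz, h⟩ ⟨k, hk⟩ e
  dsimp at k hk e
  obtain ⟨rfl, rfl⟩ | ⟨w, k₁, k₂, hw, rfl⟩ := hC k e
  · left
    obtain rfl : h = g := by simpa using hk
    exact ⟨rfl, rfl⟩
  · right
    exact ⟨⟨w, hw.trans hy, k₂ ≫ h⟩, ⟨k₁, by simpa using hk⟩, ⟨k₂, rfl⟩, hw, rfl⟩

lemma LowUnder.eqOrFactors (hC : EqOrFactors deg) :
    EqOrFactors (fun y : LowUnder deg x ↦ deg y.obj) := by
  rintro ⟨y, hy, g⟩ ⟨z, hz, h⟩ ⟨k, hk⟩ e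
  dsimp at k hk e
  obtain ⟨rfl, rfl⟩ | ⟨w, k₁, k₂, hw, rfl⟩ := hC k e
  · left
    obtain rfl : g = h := by simpa using hk
    exact ⟨rfl, rfl⟩
  · right
    exact ⟨⟨w, hw.trans hy, g ≫ k₁⟩, ⟨k₁, rfl⟩, ⟨k₂, by simpa using hk⟩, hw, rfl⟩

variable {M : Type w} [Category.{v} M] {A B : C ⥤ M} {f : A ⟶ B}

/-- Over `x`, a map `z ⟶ y` determines the structure map of its source by composition, so the
latching data at `y` are the same in `LowOver` as in `C`. -/
lemma LatchingLifts.lowOver {R : MorphismProperty M} {y : LowOver deg x}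
    (H : LatchingLifts deg R f y.obj) :
    LatchingLifts (fun y : LowOver deg x ↦ deg y.obj) R
      (Functor.whiskerLeft (LowOver.forget deg x) f) y := by
  intro Y Z p hp a b φ h₁ h₂ h₃ h₄
  obtain ⟨l, hl₁, hl₂, hl₃⟩ := H p hp a b
    (fun z k h ↦ φ ⟨z, h.trans y.lt, k ≫ y.hom⟩ ⟨k, rfl⟩ h) h₁
    (fun z k h ↦ h₂ ⟨z, h.trans y.lt, k ≫ y.hom⟩ ⟨k, rfl⟩ h)
    (fun z k h ↦ h₃ ⟨z, h.trans y.lt, k ≫ y.hom⟩ ⟨k, rfl⟩ h)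
    (fun z z' m k h h' ↦ h₄ ⟨z, h.trans y.lt, (m ≫ k) ≫ y.hom⟩ ⟨z', h'.trans y.lt, k ≫ y.hom⟩
      ⟨m, (Category.assoc _ _ _).symm⟩ ⟨k, rfl⟩ h h')
  refine ⟨l, hl₁, hl₂, ?_⟩
  rintro ⟨z, hz, g⟩ ⟨k, hk⟩ h
  dsimp at k hk
  subst hk
  exact hl₃ z k h

lemma MatchingLifts.lowUnder {L : MorphismProperty M} {y : LowUnder deg x}
    (H : MatchingLifts deg L f y.obj) :
    MatchingLifts (fun y : LowUnder deg x ↦ deg y.obj) L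
      (Functor.whiskerLeft (LowUnder.forget deg x) f) y := by
  intro Y Z i hi a b φ h₁ h₂ h₃ h₄
  obtain ⟨l, hl₁, hl₂, hl₃⟩ := H i hi a b
    (fun z k h ↦ φ ⟨z, h.trans y.lt, y.hom ≫ k⟩ ⟨k, rfl⟩ h) h₁
    (fun z k h ↦ h₂ ⟨z, h.trans y.lt, y.hom ≫ k⟩ ⟨k, rfl⟩ h)
    (fun z k h ↦ h₃ ⟨z, h.trans y.lt, y.hom ≫ k⟩ ⟨k, rfl⟩ h)
    (fun z z' m k h h' ↦ h₄ ⟨z, h.trans y.lt, y.hom ≫ k⟩ ⟨z', h'.trans y.lt, y.hom ≫ k ≫ m⟩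
      ⟨m, Category.assoc _ _ _⟩ ⟨k, rfl⟩ h h')
  refine ⟨l, hl₁, hl₂, ?_⟩
  rintro ⟨z, hz, g⟩ ⟨k, hk⟩ h
  dsimp at k hk
  subst hk
  exact hl₃ z k h

/-- Constant diagrams on the maps to `x` inherit lifting properties when factorizations through
objects of low degree are connected. -/
lemma matchingLifts_const_lowOver {y : LowOver deg x}
    (hconn : LowFactorizationsConnected deg (deg y.obj) y.obj x) {L : MorphismProperty M}
    {Y Z : M} {p : Y ⟶ Z} (hp : L.rlp p) :
    MatchingLifts (fun y : LowOver deg x ↦ deg y.obj) L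
      ((Functor.const (LowOver deg x)).map p) y := by
  intro V V' i hi a b φ h₁ h₂ h₃ h₄
  dsimp at a b φ h₁ h₂ h₃ h₄
  simp only [Category.comp_id] at h₂ h₃ h₄
  -- If `y.hom` has no lower factorization the matching family is empty and the lift comes from
  -- `hp`. Otherwise all members of `φ` agree along zigzags, and their common value is the lift.
  by_cases H : ∃ (w : LowOver deg x) (_ : y ⟶ w), deg w.obj < deg y.obj
  · obtain ⟨w, k, h⟩ := H
    refine ⟨φ w k h, h₂ _ _ _, h₃ _ _ _, fun w' k' h' ↦ ?_⟩
    dsimp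
    rw [Category.comp_id]
    have key := LowFactorization.eq_of_eqvGen_of_comp_eq y.hom
      (fun (s : LowFactorization deg (deg y.obj) y.obj x) hs ↦
        φ ⟨s.mid, s.lt.trans y.lt, s.snd⟩ ⟨s.fst, hs⟩ s.lt) ?_
      (hconn ⟨w.obj, h, k.1, w.hom⟩ ⟨w'.obj, h', k'.1, w'.hom⟩ (k.2.trans k'.2.symm)) k.2 k'.2
    · exact key
    · rintro ⟨z, hz, k₁, k₂⟩ ⟨z', hz', k₁', k₂'⟩ hs hs' ⟨m, e₁, e₂⟩
      dsimp at m e₁ e₂ hs hs'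
      subst e₁ e₂
      exact h₄ ⟨z, hz.trans y.lt, m ≫ k₂'⟩ ⟨z', hz'.trans y.lt, k₂'⟩ ⟨m, rfl⟩ ⟨k₁, hs⟩ hz hz'
  · have := hp i hi
    have sq : CommSq a i p b := ⟨h₁⟩
    exact ⟨sq.lift, sq.fac_right, sq.fac_left, fun w k h ↦ (H ⟨w, k, h⟩).elim⟩

/-- Dually, the latching object of a constant diagram at `x ⟶ y` is empty or a single copy, so the
relative latching map is `i` or an isomorphism. -/
lemma latchingLifts_const_lowUnder {y : LowUnder deg x}
    (hconn : LowFactorizationsConnected deg (deg y.obj) x y.obj) {R : MorphismProperty M}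
    {Y Z : M} {i : Y ⟶ Z} (hi : R.llp i) :
    LatchingLifts (fun y : LowUnder deg x ↦ deg y.obj) R
      ((Functor.const (LowUnder deg x)).map i) y := by
  intro V V' p hp a b φ h₁ h₂ h₃ h₄
  dsimp at a b φ h₁ h₂ h₃ h₄
  simp only [Category.id_comp] at h₂ h₃ h₄
  by_cases H : ∃ (w : LowUnder deg x) (_ : w ⟶ y), deg w.obj < deg y.obj
  · obtain ⟨w, k, h⟩ := H
    refine ⟨φ w k h, h₂ _ _ _, h₃ _ _ _, fun w' k' h' ↦ ?_⟩
    dsimp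
    rw [Category.id_comp]
    have key := LowFactorization.eq_of_eqvGen_of_comp_eq y.hom
      (fun (s : LowFactorization deg (deg y.obj) x y.obj) hs ↦
        φ ⟨s.mid, s.lt.trans y.lt, s.fst⟩ ⟨s.snd, hs⟩ s.lt) ?_
      (hconn ⟨w.obj, h, w.hom, k.1⟩ ⟨w'.obj, h', w'.hom, k'.1⟩ (k.2.trans k'.2.symm)) k.2 k'.2
    · exact key
    · rintro ⟨z, hz, k₁, k₂⟩ ⟨z', hz', k₁', k₂'⟩ hs hs' ⟨m, e₁, e₂⟩
      dsimp at m e₁ e₂ hs hs'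
      subst e₁ e₂
      exact (h₄ ⟨z, hz.trans y.lt, k₁⟩ ⟨z', hz'.trans y.lt, k₁ ≫ m⟩ ⟨m, rfl⟩ ⟨k₂', hs'⟩ hz hz').symm
  · have := hi p hp
    have sq : CommSq a i p b := ⟨h₁⟩
    exact ⟨sq.lift, sq.fac_left, sq.fac_right, fun w k h ↦ (H ⟨w, k, h⟩).elim⟩

variable (L R : MorphismProperty M) [L.IsWeakFactorizationSystem R]

/-- `L_x` is the colimit over `LowOver deg x`, and colimit is left adjoint to the constant diagram.
Lifting the latching map against `p` is thus lifting the restriction of `f` against constant `p`,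
whose relative matching maps are in `R` by connectedness. -/
theorem latchingMap_mem [HasLimitsOfSize.{u, u} M] [HasColimitsOfSize.{u, u} M] [HasPullbacks M]
    (hC : EqOrFactors deg)
    (hconn : ∀ y, deg y < deg x → LowFactorizationsConnected deg (deg y) y x)
    (hf : ∀ y, deg y < deg x → LatchingLifts deg R f y) : L (latchingMap deg x f) := by
  rw [← MorphismProperty.llp_eq_of_wfs L R]
  intro Y Z p hp
  refine ⟨fun {a b} sq ↦ ?_⟩
  have : HasLiftingProperty (Functor.whiskerLeft (LowOver.forget deg x) f)
      ((Functor.const (LowOver deg x)).map p) := by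
    refine hasLiftingProperty_of_latchingLifts (R := R) (LowOver.eqOrFactors hC)
      (fun y ↦ (hf _ y.lt).lowOver) (fun y ↦ ?_)
    rw [← MorphismProperty.rlp_eq_of_wfs L R] at hp ⊢
    rw [rlp_relMatching_iff]
    exact matchingLifts_const_lowOver (hconn _ y.lt) hp
  let ι (X : C ⥤ M) (y : LowOver deg x) : X.obj y.obj ⟶ latchingObj deg x X :=
    weightedColim.ι (homTo deg x (deg x)) (Below.ι deg (deg x) ⋙ X) (c := ⟨y.obj, y.lt⟩) y.hom
  have hι (X : C ⥤ M) {y z : LowOver deg x} (k : y ⟶ z) : X.map k.1 ≫ ι X z = ι X y := by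
    obtain ⟨y, hy, g⟩ := y
    obtain ⟨z, hz, g'⟩ := z
    obtain ⟨k, hk⟩ := k
    dsimp at k hk
    subst hk
    exact weightedColim.ι_w (homTo deg x (deg x)) (Below.ι deg (deg x) ⋙ X) (c := ⟨y, hy⟩)
      (c' := ⟨z, hz⟩) (ObjectProperty.homMk k) g'
  have hιf (y : LowOver deg x) : ι A y ≫ latchingMap deg x f = f.app y.obj ≫ ι B y :=
    weightedColim.ι_map _ _ _
  let top : LowOver.forget deg x ⋙ A ⟶ (Functor.const _).obj Y :=
    { app := fun y ↦ ι A y ≫ a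
      naturality := fun y z k ↦ by
        refine (Category.assoc _ _ _).symm.trans ((hι A k =≫ a).trans (Category.comp_id _).symm) }
  let bot : LowOver.forget deg x ⋙ B ⟶ (Functor.const _).obj Z :=
    { app := fun y ↦ ι B y ≫ b
      naturality := fun y z k ↦ by
        refine (Category.assoc _ _ _).symm.trans ((hι B k =≫ b).trans (Category.comp_id _).symm) }
  have sq' : CommSq top (Functor.whiskerLeft (LowOver.forget deg x) f)
      ((Functor.const (LowOver deg x)).map p) bot := ⟨by
    ext y
    have := hιf y
    change (ι A y ≫ a) ≫ p = f.app y.obj ≫ ι B y ≫ b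
    rw [Category.assoc, sq.w, reassoc_of% this]⟩
  have hl₁ (y) := congr_app sq'.fac_left y
  have hl₂ (y) := congr_app sq'.fac_right y
  have hl₃ {y z : LowOver deg x} (k : y ⟶ z) := sq'.lift.naturality k
  -- Naturality of the lift into a constant diagram is exactly the compatibility needed to descend
  -- to the weighted colimit.
  let l : latchingObj deg x B ⟶ Y := weightedColim.desc _ _
    (fun y k ↦ sq'.lift.app ⟨y.obj, y.property, k⟩) (fun y z m k ↦ by
      refine ((Category.comp_id _).symm.trans (hl₃ (y := ⟨y.obj, y.property, m.hom ≫ k⟩)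
        (z := ⟨z.obj, z.property, k⟩) ⟨m.hom, rfl⟩).symm))
  have hl (y : LowOver deg x) : ι B y ≫ l = sq'.lift.app y := weightedColim.ι_desc _ _ _ _ _
  refine ⟨⟨⟨l, ?_, ?_⟩⟩⟩
  · apply weightedColim.hom_ext
    intro y k
    have h₁ := hιf ⟨y.obj, y.property, k⟩
    have h₂ := hl ⟨y.obj, y.property, k⟩
    change ι A ⟨y.obj, y.property, k⟩ ≫ _ = ι A ⟨y.obj, y.property, k⟩ ≫ _
    rw [reassoc_of% h₁, h₂]
    exact hl₁ ⟨y.obj, y.property, k⟩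
  · apply weightedColim.hom_ext
    intro y k
    have h₂ := hl ⟨y.obj, y.property, k⟩
    change ι B ⟨y.obj, y.property, k⟩ ≫ _ = ι B ⟨y.obj, y.property, k⟩ ≫ _
    rw [reassoc_of% h₂]
    exact hl₂ ⟨y.obj, y.property, k⟩

/-- The adjunction between constant diagrams and limits over `LowUnder deg x` puts the constant
diagram on the left of the lifting problem, so its relative latching conditions are what
connectedness must provide. -/
theorem matchingMap_mem [HasLimitsOfSize.{u, u} M] [HasPullbacks M]
    (hC : EqOrFactors deg)
    (hconn : ∀ y, deg y < deg x → LowFactorizationsConnected deg (deg y) x y)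
    (hf : ∀ y, deg y < deg x → MatchingLifts deg L f y) : R (matchingMap deg x f) := by
  rw [← MorphismProperty.rlp_eq_of_wfs L R]
  intro Y Z i hi
  refine ⟨fun {a b} sq ↦ ?_⟩
  have : HasLiftingProperty ((Functor.const (LowUnder deg x)).map i)
      (Functor.whiskerLeft (LowUnder.forget deg x) f) := by
    refine hasLiftingProperty_of_latchingLifts (R := R) (LowUnder.eqOrFactors hC)
      (fun y ↦ ?_) (fun y ↦ ?_)
    · rw [← MorphismProperty.llp_eq_of_wfs L R] at hi
      exact latchingLifts_const_lowUnder (hconn _ y.lt) hi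
    · rw [← MorphismProperty.rlp_eq_of_wfs L R, rlp_relMatching_iff]
      exact (hf _ y.lt).lowUnder
  let π (X : C ⥤ M) (y : LowUnder deg x) : matchingObj deg x X ⟶ X.obj y.obj :=
    (homFrom deg x (deg x)).weightedLimObjObjπ (Below.ι deg (deg x) ⋙ X) (j := ⟨y.obj, y.lt⟩) y.hom
  have hπ (X : C ⥤ M) {y z : LowUnder deg x} (k : y ⟶ z) : π X y ≫ X.map k.1 = π X z := by
    obtain ⟨y, hy, g⟩ := y
    obtain ⟨z, hz, g'⟩ := z
    obtain ⟨k, hk⟩ := k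
    dsimp at k hk
    subst hk
    exact Functor.weightedLimObjObj_w (homFrom deg x (deg x)) (Below.ι deg (deg x) ⋙ X)
      (j₁ := ⟨y, hy⟩) (j₂ := ⟨z, hz⟩) g (ObjectProperty.homMk k)
  have hπf (y : LowUnder deg x) : matchingMap deg x f ≫ π B y = π A y ≫ f.app y.obj :=
    Functor.weightedLimObjMap_π _ _ _
  let top : (Functor.const _).obj Y ⟶ LowUnder.forget deg x ⋙ A :=
    { app := fun y ↦ a ≫ π A y
      naturality := fun y z k ↦ by
        refine (Category.id_comp _).trans ((a ≫= hπ A k).symm.trans (Category.assoc _ _ _).symm) }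
  let bot : (Functor.const _).obj Z ⟶ LowUnder.forget deg x ⋙ B :=
    { app := fun y ↦ b ≫ π B y
      naturality := fun y z k ↦ by
        refine (Category.id_comp _).trans ((b ≫= hπ B k).symm.trans (Category.assoc _ _ _).symm) }
  have sq' : CommSq top ((Functor.const (LowUnder deg x)).map i)
      (Functor.whiskerLeft (LowUnder.forget deg x) f) bot := ⟨by
    ext y
    have h₁ := hπf y
    have h₂ := sq.w
    change (a ≫ π A y) ≫ f.app y.obj = i ≫ b ≫ π B y
    rw [← reassoc_of% h₂, h₁, Category.assoc]⟩
  have hl₁ (y) := congr_app sq'.fac_left y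
  have hl₂ (y) := congr_app sq'.fac_right y
  have hl₃ {y z : LowUnder deg x} (k : y ⟶ z) := sq'.lift.naturality k
  let l : Z ⟶ matchingObj deg x A :=
    ((homFrom deg x (deg x)).isLimitWeightedLimCone (Below.ι deg (deg x) ⋙ A)).lift
    (fun y k ↦ sq'.lift.app ⟨y.obj, y.property, k⟩) (fun y z k m ↦ by
      exact ((Category.id_comp _).symm.trans (hl₃ (y := ⟨y.obj, y.property, k⟩)
        (z := ⟨z.obj, z.property, k ≫ m.hom⟩) ⟨m.hom, rfl⟩)).symm)
  have hl (y : LowUnder deg x) : l ≫ π A y = sq'.lift.app y :=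
    Functor.isLimitWeightedLimCone_fac _ _ _ _ _
  refine ⟨⟨⟨l, ?_, ?_⟩⟩⟩
  · apply Functor.weightedLimObjObj.hom_ext
    intro y k
    have h₂ := hl ⟨y.obj, y.property, k⟩
    change _ ≫ π A ⟨y.obj, y.property, k⟩ = _ ≫ π A ⟨y.obj, y.property, k⟩
    rw [Category.assoc, h₂]
    exact hl₁ ⟨y.obj, y.property, k⟩
  · apply Functor.weightedLimObjObj.hom_ext
    intro y k
    have h₁ := hπf ⟨y.obj, y.property, k⟩
    have h₂ := hl ⟨y.obj, y.property, k⟩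
    change _ ≫ π B ⟨y.obj, y.property, k⟩ = _ ≫ π B ⟨y.obj, y.property, k⟩
    rw [Category.assoc, h₁, reassoc_of% h₂]
    exact hl₂ ⟨y.obj, y.property, k⟩

end Latching

/-! ### Reedy weak factorization systems -/

section ReedyWFS

variable {C : Type u} [Category.{u} C] (deg : C → Ordinal.{t}) {M : Type w} [Category.{v} M]

/-- The natural transformations whose relative latching maps belong to `L`. -/
def reedyLeft [HasColimitsOfSize.{u, u} M] [HasPushouts M] (L : MorphismProperty M) :
    MorphismProperty (C ⥤ M) :=
  fun _ _ f ↦ ∀ x : C, L (relLatching deg x f)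

/-- The natural transformations whose relative matching maps belong to `R`. -/
def reedyRight [HasLimitsOfSize.{u, u} M] [HasPullbacks M] (R : MorphismProperty M) :
    MorphismProperty (C ⥤ M) :=
  fun _ _ f ↦ ∀ x : C, R (relMatching deg x f)

variable {deg} (L R : MorphismProperty M) [L.IsWeakFactorizationSystem R]

lemma reedyLeft_iff [HasColimitsOfSize.{u, u} M] [HasPushouts M] {A B : C ⥤ M} (f : A ⟶ B) :
    reedyLeft deg L f ↔ ∀ x, LatchingLifts deg R f x := by
  simp only [reedyLeft, ← llp_relLatching_iff, MorphismProperty.llp_eq_of_wfs L R]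

lemma reedyRight_iff [HasLimitsOfSize.{u, u} M] [HasPullbacks M] {A B : C ⥤ M} (f : A ⟶ B) :
    reedyRight deg R f ↔ ∀ x, MatchingLifts deg L f x := by
  simp only [reedyRight, ← rlp_relMatching_iff, MorphismProperty.rlp_eq_of_wfs L R]

variable [HasLimitsOfSize.{u, u} M] [HasColimitsOfSize.{u, u} M] [HasPullbacks M] [HasPushouts M]

/-- The Reedy weak factorization system. -/
theorem IsBistratifiedDiscrete.isWeakFactorizationSystem (hC : IsBistratifiedDiscrete deg) :
    (reedyLeft deg L : MorphismProperty (C ⥤ M)).IsWeakFactorizationSystem (reedyRight deg R) := by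
  have : (reedyLeft deg L : MorphismProperty (C ⥤ M)).HasFactorization (reedyRight deg R) := by
    refine ⟨fun f ↦ ?_⟩
    obtain ⟨E, i, p, fac, hi, hp⟩ := exists_reedy_factorization hC.eqOrFactors
      (fun _ _ h k₁ k₂ ↦ hC.comp_ne_id h k₁ k₂) (fun _ _ h ↦ hC.connected h) L R f
    exact ⟨⟨E, i, p, fac, (reedyLeft_iff L R i).2 hi, (reedyRight_iff L R p).2 hp⟩⟩
  have : (reedyLeft deg L : MorphismProperty (C ⥤ M)).IsStableUnderRetracts :=
    ⟨fun r h ↦ (reedyLeft_iff L R _).2 fun x ↦ ((reedyLeft_iff L R _).1 h x).of_retract r⟩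
  have : (reedyRight deg R : MorphismProperty (C ⥤ M)).IsStableUnderRetracts :=
    ⟨fun r h ↦ (reedyRight_iff L R _).2 fun x ↦ ((reedyRight_iff L R _).1 h x).of_retract r⟩
  exact .mk' _ _ fun i p hi hp ↦
    hasLiftingProperty_of_latchingLifts hC.eqOrFactors ((reedyLeft_iff L R i).1 hi) hp

end ReedyWFS

/-! ### Compatibility with weak equivalences and the model structure -/

section ModelStructure

variable {C : Type u} [Category.{u} C] {deg : C → Ordinal.{t}} {M : Type w} [Category.{v} M]

/-- `f.app x` is a cobase change of `L_x A ⟶ L_x B` followed by the relative latching map. When the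
relative latching maps below `x` are acyclic cofibrations, so is that cobase change, and
two-out-of-three compares the other two maps. -/
lemma IsAlmostReedy.reedyLeft_trivialCofibrations_iff [HasLimitsOfSize.{u, u} M]
    [HasColimitsOfSize.{u, u} M] [ModelCategory M] (hC : IsAlmostReedy deg) {A B : C ⥤ M}
    (f : A ⟶ B) :
    reedyLeft deg (trivialCofibrations M) f ↔
      reedyLeft deg (cofibrations M) f ∧ ∀ x, weakEquivalences M (f.app x) := by
  have hL (x : C) (h : ∀ y, deg y < deg x → trivialCofibrations M (relLatching deg y f)) :
      WeakEquivalence (pushout.inr (latchingMap deg x f) (fromLatching deg x A)) := by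
    have hx : trivialCofibrations M (latchingMap deg x f) := by
      refine latchingMap_mem _ (fibrations M) hC.bistratified.eqOrFactors
        (fun y hy ↦ hC.connected_of_gt hy) fun y hy ↦ ?_
      rw [← llp_relLatching_iff, MorphismProperty.llp_eq_of_wfs (trivialCofibrations M)]
      exact h y hy
    obtain ⟨_, _⟩ := (mem_trivialCofibrations_iff _).1 hx
    infer_instance
  have hfac (x : C) : pushout.inr _ _ ≫ relLatching deg x f = f.app x := pushout.inr_desc _ _ _
  constructor
  · refine fun h ↦ ⟨fun x ↦ (h x).1, fun x ↦ ?_⟩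
    have := hL x fun y _ ↦ h y
    have : WeakEquivalence (relLatching deg x f) := ⟨(h x).2⟩
    rw [← weakEquivalence_iff, ← hfac]
    infer_instance
  · rintro ⟨h, hw⟩ x
    -- Acyclicity of `L_x A ⟶ L_x B` depends on the relative latching maps in lower degree, not
    -- merely on `f` being an objectwise weak equivalence, hence the induction.
    induction x using (InvImage.wf deg wellFounded_lt).induction with
    | _ x ih =>
      have := hL x ih
      have : WeakEquivalence (f.app x) := ⟨hw x⟩
      exact ⟨h x, (weakEquivalence_of_precomp_of_fac (hfac x)).mem⟩

lemma IsAlmostReedy.reedyRight_trivialFibrations_iff [HasLimitsOfSize.{u, u} M]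
    [ModelCategory M] (hC : IsAlmostReedy deg) {A B : C ⥤ M} (f : A ⟶ B) :
    reedyRight deg (trivialFibrations M) f ↔
      reedyRight deg (fibrations M) f ∧ ∀ x, weakEquivalences M (f.app x) := by
  have hR (x : C) (h : ∀ y, deg y < deg x → trivialFibrations M (relMatching deg y f)) :
      WeakEquivalence (pullback.snd (matchingMap deg x f) (toMatching deg x B)) := by
    have hx : trivialFibrations M (matchingMap deg x f) := by
      refine matchingMap_mem (cofibrations M) _ hC.bistratified.eqOrFactors
        (fun y hy ↦ hC.connected_of_lt hy) fun y hy ↦ ?_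
      rw [← rlp_relMatching_iff, MorphismProperty.rlp_eq_of_wfs _ (trivialFibrations M)]
      exact h y hy
    obtain ⟨_, _⟩ := (mem_trivialFibrations_iff _).1 hx
    infer_instance
  have hfac (x : C) : relMatching deg x f ≫ pullback.snd _ _ = f.app x := pullback.lift_snd _ _ _
  constructor
  · refine fun h ↦ ⟨fun x ↦ (h x).1, fun x ↦ ?_⟩
    have := hR x fun y _ ↦ h y
    have : WeakEquivalence (relMatching deg x f) := ⟨(h x).2⟩
    rw [← weakEquivalence_iff, ← hfac]
    infer_instance
  · rintro ⟨h, hw⟩ x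
    induction x using (InvImage.wf deg wellFounded_lt).induction with
    | _ x ih =>
      have := hR x ih
      have : WeakEquivalence (f.app x) := ⟨hw x⟩
      exact ⟨h x, (weakEquivalence_of_postcomp_of_fac (hfac x)).mem⟩

/-- The natural transformations which are objectwise weak equivalences. -/
def levelwiseWeakEquivalences (C : Type u) [Category.{u} C] (M : Type w) [Category.{v} M]
    [CategoryWithWeakEquivalences M] : MorphismProperty (C ⥤ M) :=
  fun _ _ f ↦ ∀ x : C, weakEquivalences M (f.app x)

instance [ModelCategory M] : (levelwiseWeakEquivalences C M).HasTwoOutOfThreeProperty where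
  comp_mem _ _ hf hg x := (weakEquivalences M).comp_mem _ _ (hf x) (hg x)
  of_postcomp _ _ hg hfg x := (weakEquivalences M).of_postcomp _ _ (hg x) (hfg x)
  of_precomp _ _ hf hfg x := (weakEquivalences M).of_precomp _ _ (hf x) (hfg x)

end ModelStructure

theorem mainTheorem2 {C : Type u} [Category.{u} C] (deg : C → Ordinal.{t})
    (hC : IsAlmostReedy deg)
    (M : Type w) [Category.{v} M] [HasLimitsOfSize.{u, u} M] [HasColimitsOfSize.{u, u} M]
    [ModelCategory M] :
    ∃ _ : ModelCategory (C ⥤ M),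
      (∀ ⦃A B : C ⥤ M⦄ (f : A ⟶ B),
        weakEquivalences (C ⥤ M) f ↔ ∀ x : C, weakEquivalences M (f.app x)) ∧
      (∀ ⦃A B : C ⥤ M⦄ (f : A ⟶ B),
        fibrations (C ⥤ M) f ↔ ∀ x : C, fibrations M (relMatching deg x f)) ∧
      (∀ ⦃A B : C ⥤ M⦄ (f : A ⟶ B),
        trivialFibrations (C ⥤ M) f ↔ ∀ x : C, trivialFibrations M (relMatching deg x f)) ∧
      (∀ ⦃A B : C ⥤ M⦄ (f : A ⟶ B),
        cofibrations (C ⥤ M) f ↔ ∀ x : C, cofibrations M (relLatching deg x f)) ∧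
      (∀ ⦃A B : C ⥤ M⦄ (f : A ⟶ B),
        trivialCofibrations (C ⥤ M) f ↔ ∀ x : C, trivialCofibrations M (relLatching deg x f)) := by
  let : CategoryWithFibrations (C ⥤ M) := ⟨reedyRight deg (fibrations M)⟩
  let : CategoryWithCofibrations (C ⥤ M) := ⟨reedyLeft deg (cofibrations M)⟩
  let : CategoryWithWeakEquivalences (C ⥤ M) := ⟨levelwiseWeakEquivalences C M⟩
  -- The acyclic classes are by definition intersections with the objectwise weak equivalences;
  -- identifying them with Reedy classes makes both required factorization systems instances of the
  -- Reedy one.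
  have hcof : trivialCofibrations (C ⥤ M) = reedyLeft deg (trivialCofibrations M) := by
    ext A B f
    exact (hC.reedyLeft_trivialCofibrations_iff f).symm
  have hfib : trivialFibrations (C ⥤ M) = reedyRight deg (trivialFibrations M) := by
    ext A B f
    exact (hC.reedyRight_trivialFibrations_iff f).symm
  have : (weakEquivalences (C ⥤ M)).HasTwoOutOfThreeProperty :=
    inferInstanceAs (levelwiseWeakEquivalences C M).HasTwoOutOfThreeProperty
  have : (cofibrations (C ⥤ M)).IsWeakFactorizationSystem (trivialFibrations (C ⥤ M)) := by
    rw [hfib]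
    exact hC.bistratified.isWeakFactorizationSystem (cofibrations M) (trivialFibrations M)
  have : (trivialCofibrations (C ⥤ M)).IsWeakFactorizationSystem (fibrations (C ⥤ M)) := by
    rw [hcof]
    exact hC.bistratified.isWeakFactorizationSystem (trivialCofibrations M) (fibrations M)
  -- Two-out-of-three and the two weak factorization systems suffice here; retract closure of weak
  -- equivalences is not a separate input.
  refine ⟨ModelCategory.mk' (C ⥤ M), fun _ _ _ ↦ Iff.rfl, fun _ _ _ ↦ Iff.rfl, fun _ _ f ↦ ?_,
    fun _ _ _ ↦ Iff.rfl, fun _ _ f ↦ ?_⟩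
  · exact (hC.reedyRight_trivialFibrations_iff f).symm
  · exact (hC.reedyLeft_trivialCofibrations_iff f).symm
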